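/- Let \(k(z)=\sum_{n\ge 0}a_nz^n\) be an analytic function on the open unit disc \(\mathbb D\) without zeros in \(\mathbb D\), with \(a_0=1\), \(a_n>0\) for all \(n\), \(0<\inf_n \frac{a_n}{a_{n+1}}\le\sup_n\frac{a_n}{a_{n+1}}<\infty\), and such that the limit \(\lim_{n\to\infty}\frac{a_n}{a_{n+1}}\) exists. Let \(1/k=\sum_n c_nz^n\) on \(\mathbb D\) and \(F(z)=\sum_{n\ge0}a_{n+1}z^n\). Let \(\mathbb B_d\subset\mathbb C^d\) be the open unit ball, \(K(z,w)=k(\langle z,w\rangle)\), and, for a complex Hilbert space \(\mathscr E\), let \(H_K(\mathscr E)\) be the \(\mathscr E\)-valued functional Hilbert space on \(\mathbb B_d\) with reproducing kernel \(K(z,w)1_{\mathscr E}\). Let \(M_z=(M_{z_1},\dots,M_{z_d})\) be the tuple of multiplications by the coordinate functions on it, and write \(M_z^*\colon H_K(\mathscr E)\to H_K(\mathscr E)^d\), \(M_z^*f=(M_{z_i}^*f)_{i}\). Put \(\gamma_\alpha=|\alpha|!/\alpha!\) for \(\alpha\in\mathbb N^d\). A commuting tuple \(T=(T_1,\dots,T_d)\)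 of bounded operators on a complex Hilbert space \(H\) is a \(K\)-contraction if, with \(\sigma_T(X)=\sum_{i}T_iXT_i^*\), the limit \(\frac1K(T)=\mathrm{SOT}\text{-}\sum_{n}c_n\sigma_T^n(1_H)\) exists and is a positive operator; it is pure if in addition \(\mathrm{SOT}\text{-}\lim_{N}\bigl(1_H-\sum_{n=0}^Na_n\sigma_T^n(\tfrac1K(T))\bigr)=0\). For a pure \(K\)-contraction \(T\in L(H)^d\) and an operator \(C\in L(H,\mathscr E)\) with \(C^*C=\frac1K(T)\), let \(j_C\colon H\to H_K(\mathscr E)\), \(j_Ch=\sum_{\alpha}a_{|\alpha|}\gamma_\alpha\,(CT^{*\alpha}h)\,z^\alpha\). Let \(j\) be the map \(j_C\) for \(C=\frac1K(T)^{1/2}\), regarded as an operator from \(H\) into \(\mathscr D=\overline{\operatorname{Im}\frac1K(T)^{1/2}}\), and let \(\Delta_T=j^*\Delta j\), where \(\Delta\) is the bounded operator on \(H_K(\mathscr D)\) with \(\Delta\bigl(\sum_\alpha f_\alpha z^\alpha\bigr)=\sum_\alpha\frac{a_{|\alpha|+1}}{a_{|\alpha|}}f_\alpha z^\alpha\). For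 \(z\in\mathbb B_d\) let \(Z\colon H^d\to H\), \(Z(h_i)_i=\sum_iz_ih_i\). Regard \(T\) as the row operator \(H^d\to H\), \((h_i)_i\mapsto\sum_iT_ih_i\), so that \(T^*\colon H\to H^d\) and \(ZT^*=\sum_iz_iT_i^*\in L(H)\), and set \(F(ZT^*)=\sum_{n}a_{n+1}(ZT^*)^n\). **Theorem.** Let \(T\in L(H)^d\) be a pure \(K\)-contraction, let \(\mathscr E,\mathscr E_*\) be complex Hilbert spaces, and let \(B\in L(\mathscr E_*,H^d)\), \(C\in L(H,\mathscr E)\), \(D\in L(\mathscr E_*,\mathscr E)\) satisfy - (K1) \(C^*C=\frac1K(T)\), - (K2) \(D^*C+B^*(\oplus\Delta_T)T^*=0\), - (K3) \(D^*D+B^*(\oplus\Delta_T)B=1_{\mathscr E_*}\), - (K4) \(\operatorname{Im}((\oplus j_C)B)\subset M_z^*H_K(\mathscr E)\). Let \(W\colon\mathbb B_d\to L(\mathscr E_*,\mathscr E)\) be given by \(W(z)=D+CF(ZT^*)ZB\). Then \(W\) is a \(K\)-inner function. That is, \(W\) is analytic; for every \(x\in\mathscr E_*\) the function \(Wx\colon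 z\mapsto W(z)x\) belongs to \(H_K(\mathscr E)\); the map \(\mathscr E_*\to H_K(\mathscr E)\), \(x\mapsto Wx\), is a linear isometry; and \(W\mathscr E_*\perp M_z^\alpha(W\mathscr E_*)\) for all \(\alpha\in\mathbb N^d\setminus\{0\}\). -/

import Mathlib

open Filter Topology ContinuousLinearMap
open scoped InnerProductSpace

noncomputable section

namespace KInner

/-- The power series `k(z) = ∑ aₙ zⁿ` that generates the kernel `K(z, w) = k(⟨z, w⟩)`. -/
structure KernelSeries where
  /-- the coefficients `aₙ` -/
  a : ℕ → ℝ
  a_zero : a 0 = 1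
  a_pos : ∀ n, 0 < a n
  /-- `k` is analytic on the open unit disc -/
  summable : ∀ z : ℂ, ‖z‖ < 1 → Summable fun n => (a n : ℂ) * z ^ n
  /-- `k` has no zeros in the open unit disc -/
  ne_zero : ∀ z : ℂ, ‖z‖ < 1 → ∑' n, (a n : ℂ) * z ^ n ≠ 0
  inf_pos : 0 < ⨅ n, a n / a (n + 1)
  sup_finite : BddAbove (Set.range fun n => a n / a (n + 1))

namespace KernelSeries

variable (κ : KernelSeries)

/-- The analytic function `k` on the unit disc. -/
def k (z : ℂ) : ℂ := ∑' n, (κ.a n : ℂ) * z ^ n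

/-- The Taylor coefficients at `0` of the reciprocal `1 / k`. -/
def c (n : ℕ) : ℂ := iteratedDeriv n (fun z => 1 / κ.k z) 0 / (n.factorial : ℂ)

/-- `a_{|α|} γ_α` with `γ_α = |α|! / α!`. -/
def weight {d : ℕ} (α : Fin d → ℕ) : ℝ :=
  κ.a (∑ i, α i) * Nat.multinomial Finset.univ α

lemma weight_pos {d : ℕ} (α : Fin d → ℕ) : 0 < κ.weight α :=
  mul_pos (κ.a_pos _) (by exact_mod_cast Nat.multinomial_pos _ _)

lemma summable_real {x : ℝ} (h0 : 0 ≤ x) (h1 : x < 1) : Summable fun n => κ.a n * x ^ n := by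
  have := (κ.summable x (by simpa [abs_of_nonneg h0] using h1)).norm
  refine this.congr fun n => ?_
  simp [abs_of_nonneg h0, abs_of_pos (κ.a_pos n)]

end KernelSeries

/-- Grouping of the multi-indices by their length. -/
lemma sum_piAntidiag_weight (κ : KernelSeries) {d : ℕ} {R : Type*} [CommRing R] [Algebra ℝ R]
    (x : Fin d → R) (n : ℕ) :
    ∑ α ∈ Finset.piAntidiag Finset.univ n, algebraMap ℝ R (κ.weight α) * ∏ i, x i ^ α i
      = algebraMap ℝ R (κ.a n) * (∑ i, x i) ^ n := by
  rw [Finset.sum_pow_eq_sum_piAntidiag, Finset.mul_sum]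
  refine Finset.sum_congr rfl fun α hα => ?_
  rw [Finset.mem_piAntidiag] at hα
  simp [KernelSeries.weight, hα.1, mul_assoc]

/-- A finite set of multi-indices lies in a finite union of levels. -/
lemma sum_le_sum_levels {d : ℕ} (g : (Fin d → ℕ) → ℝ) (hg : ∀ α, 0 ≤ g α)
    (s : Finset (Fin d → ℕ)) :
    ∃ N₀, ∀ N ≥ N₀, ∑ α ∈ s, g α ≤
      ∑ n ∈ Finset.range N, ∑ α ∈ Finset.piAntidiag Finset.univ n, g α := by
  classical
  refine ⟨s.sup (fun α => ∑ i, α i) + 1, fun N hN => ?_⟩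
  rw [← Finset.sum_biUnion]
  · refine Finset.sum_le_sum_of_subset_of_nonneg (fun α hα => ?_) fun α _ _ => hg α
    rw [Finset.mem_biUnion]
    have : ∑ i, α i ≤ s.sup (fun α => ∑ i, α i) := Finset.le_sup (f := fun α => ∑ i, α i) hα
    exact ⟨∑ i, α i, Finset.mem_range.2 (by omega), by simp [Finset.mem_piAntidiag]⟩
  · intro m _ n _ hmn
    refine Finset.disjoint_left.2 fun α h1 h2 => hmn ?_
    rw [Finset.mem_piAntidiag] at h1 h2
    exact h1.1.symm.trans h2.1

lemma hasSum_levels {d : ℕ} {V : Type*} [NormedAddCommGroup V] [CompleteSpace V]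
    {g : (Fin d → ℕ) → V} {x : V} (hg : HasSum g x) :
    HasSum (fun n => ∑ α ∈ Finset.piAntidiag Finset.univ n, g α) x := by
  classical
  let e : (Σ n : ℕ, {α : Fin d → ℕ // α ∈ Finset.piAntidiag Finset.univ n}) ≃ (Fin d → ℕ) :=
    { toFun := fun p => p.2.1
      invFun := fun α => ⟨∑ i, α i, α, by simp [Finset.mem_piAntidiag]⟩
      left_inv := by
        rintro ⟨n, α, hα⟩
        rw [Finset.mem_piAntidiag] at hα
        obtain ⟨rfl, -⟩ := hα
        rfl
      right_inv := fun α => rfl }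
  have h := (e.hasSum_iff.2 hg).sigma (g := fun n => ∑ α ∈ Finset.piAntidiag Finset.univ n, g α)
    fun n => by
      rw [← Finset.sum_coe_sort]
      exact hasSum_fintype _
  exact h


/-- A bounded linear map into a Hilbert sum, given by its components. -/
def lpMk {ι X E : Type*} [NormedAddCommGroup X] [NormedSpace ℂ X] [NormedAddCommGroup E]
    [InnerProductSpace ℂ E] (L : ι → X →ₗ[ℂ] E) (C : ℝ)
    (h : ∀ (x : X) (s : Finset ι), ∑ i ∈ s, ‖L i x‖ ^ 2 ≤ C * ‖x‖ ^ 2) :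
    X →L[ℂ] lp (fun _ : ι => E) 2 :=
  LinearMap.mkContinuous
    { toFun := fun x => ⟨fun i => L i x, memℓp_gen' (C := C * ‖x‖ ^ 2) (by simpa using h x)⟩
      map_add' := fun x y => by ext i; exact map_add (L i) x y
      map_smul' := fun c x => by ext i; exact map_smul (L i) c x }
    (√ (max C 0))
    (fun x => lp.norm_le_of_forall_sum_le (by simp) (by positivity) fun s => by
      have h2 : C * ‖x‖ ^ 2 ≤ max C 0 * ‖x‖ ^ 2 := by gcongr; exact le_max_left _ _
      have h3 : (0 : ℝ) ≤ max C 0 := le_max_right _ _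
      simpa [mul_pow, Real.sq_sqrt h3] using (h x s).trans h2)

@[simp]
lemma lpMk_apply {ι X E : Type*} [NormedAddCommGroup X] [NormedSpace ℂ X] [NormedAddCommGroup E]
    [InnerProductSpace ℂ E] (L : ι → X →ₗ[ℂ] E) (C : ℝ)
    (h : ∀ (x : X) (s : Finset ι), ∑ i ∈ s, ‖L i x‖ ^ 2 ≤ C * ‖x‖ ^ 2) (x : X) (i : ι) :
    lpMk L C h x i = L i x := rfl

/-- The open unit ball of `ℂ^d`. -/
abbrev Ball (d : ℕ) : Set (EuclideanSpace ℂ (Fin d)) := Metric.ball 0 1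

lemma summable_weight (κ : KernelSeries) {d : ℕ} {z : EuclideanSpace ℂ (Fin d)} (hz : z ∈ Ball d) :
    Summable fun α : Fin d → ℕ => κ.weight α * ‖∏ i, z i ^ α i‖ ^ 2 := by
  have hx : ‖z‖ ^ 2 < 1 := by
    have : ‖z‖ < 1 := by simpa using hz
    have h0 := norm_nonneg z
    nlinarith
  have hs := κ.summable_real (sq_nonneg ‖z‖) hx
  have h0 : ∀ α : Fin d → ℕ, 0 ≤ κ.weight α * ‖∏ i, z i ^ α i‖ ^ 2 := fun α =>
    mul_nonneg (κ.weight_pos α).le (sq_nonneg _)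
  refine summable_of_sum_le h0 (c := ∑' n, κ.a n * (‖z‖ ^ 2) ^ n) fun s => ?_
  obtain ⟨N, hN⟩ := sum_le_sum_levels _ h0 s
  refine (hN N le_rfl).trans ?_
  refine le_trans (le_of_eq ?_) (hs.sum_le_tsum (Finset.range N) fun n _ =>
    mul_nonneg (κ.a_pos n).le (by positivity))
  refine Finset.sum_congr rfl fun n _ => ?_
  have := sum_piAntidiag_weight κ (fun i => ‖z i‖ ^ 2) n
  simp only [Algebra.algebraMap_self, RingHom.id_apply] at this
  rw [EuclideanSpace.norm_sq_eq, ← this]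
  refine Finset.sum_congr rfl fun α _ => ?_
  simp only [norm_prod, norm_pow, ← Finset.prod_pow, ← pow_mul, mul_comm]

/-- The `E`-valued functional Hilbert space `H_K(E)` on the unit ball with the reproducing kernel
`K(z, w) 1_E`, coordinatized by the orthonormal monomials: `g` stands for the function
`f(z) = ∑_α f_α z^α` with `f_α = √(a_{|α|} γ_α) g_α` (see `coeff`, `apply_eq_tsum` and
`kernel_eq`). -/
def HK (_κ : KernelSeries) (d : ℕ) (E : Type*) [NormedAddCommGroup E] : Type _ :=
  lp (fun _ : Fin d → ℕ => E) 2

namespace HK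

variable {κ : KernelSeries} {d : ℕ} {E : Type*} [NormedAddCommGroup E]

instance : NormedAddCommGroup (HK κ d E) :=
  inferInstanceAs (NormedAddCommGroup (lp (fun _ : Fin d → ℕ => E) 2))

variable [InnerProductSpace ℂ E]

instance : InnerProductSpace ℂ (HK κ d E) :=
  inferInstanceAs (InnerProductSpace ℂ (lp (fun _ : Fin d → ℕ => E) 2))

instance [CompleteSpace E] : CompleteSpace (HK κ d E) :=
  inferInstanceAs (CompleteSpace (lp (fun _ : Fin d → ℕ => E) 2))

/-- The coordinates with respect to the orthonormal monomials. -/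
def toLp : HK κ d E ≃ₗᵢ[ℂ] lp (fun _ : Fin d → ℕ => E) 2 := LinearIsometryEquiv.refl ℂ _

/-- The Taylor coefficient `f_α` of `f`. -/
def coeff (f : HK κ d E) (α : Fin d → ℕ) : E := ((√ (κ.weight α) : ℝ) : ℂ) • toLp f α

variable (κ) in
lemma summable_eval_norm (f : HK κ d E) {z : EuclideanSpace ℂ (Fin d)} (hz : z ∈ Ball d) :
    Summable fun α : Fin d → ℕ => ‖(∏ i, z i ^ α i) • coeff f α‖ := by
  have h1 := summable_weight κ hz
  have h2 := (lp.hasSum_norm (by simp) (toLp f)).summable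
  refine Summable.of_nonneg_of_le (fun _ => norm_nonneg _) (fun α => ?_) (h1.add h2)
  have h3 := Real.sq_sqrt (κ.weight_pos α).le
  simp only [coeff, norm_smul, ENNReal.toReal_ofNat, Real.rpow_ofNat, Complex.norm_real,
    Real.norm_eq_abs, abs_of_nonneg (Real.sqrt_nonneg _)]
  nth_rw 2 [← h3]
  rw [← mul_pow]
  nlinarith [sq_nonneg (√ (κ.weight α) * ‖∏ i, z i ^ α i‖ - ‖toLp f α‖),
    sq_nonneg (√ (κ.weight α) * ‖∏ i, z i ^ α i‖ + ‖toLp f α‖)]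

/-- The element `K(·, w) v` of `H_K(E)`, as a bounded operator in `v`. -/
def kerL (κ : KernelSeries) (E : Type*) [NormedAddCommGroup E] [InnerProductSpace ℂ E]
    (w : Ball d) : E →L[ℂ] HK κ d E :=
  toLp.symm.toContinuousLinearEquiv.toContinuousLinearMap ∘L
    lpMk (fun α => ((√ (κ.weight α) : ℝ) * star (∏ i, w.1 i ^ α i) : ℂ) • LinearMap.id)
      (∑' α : Fin d → ℕ, κ.weight α * ‖∏ i, w.1 i ^ α i‖ ^ 2) (fun v s => by
        refine le_trans (le_of_eq ?_) (mul_le_mul_of_nonneg_right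
          ((summable_weight κ w.2).sum_le_tsum s fun α _ =>
            mul_nonneg (κ.weight_pos α).le (sq_nonneg _)) (sq_nonneg _))
        rw [Finset.sum_mul]
        refine Finset.sum_congr rfl fun α _ => ?_
        simp only [LinearMap.smul_apply, LinearMap.id_apply, norm_smul, norm_mul,
          Complex.norm_real, mul_pow, norm_star, Real.norm_eq_abs, sq_abs,
          Real.sq_sqrt (κ.weight_pos α).le])

lemma toLp_kerL (w : Ball d) (v : E) (α : Fin d → ℕ) :
    toLp (kerL κ E w v) α = ((√ (κ.weight α) : ℝ) * star (∏ i, w.1 i ^ α i) : ℂ) • v := rfl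

variable [CompleteSpace E]

lemma inner_kerL (w : Ball d) (v : E) (f : HK κ d E) :
    ⟪kerL κ E w v, f⟫_ℂ = ⟪v, ∑' α : Fin d → ℕ, (∏ i, w.1 i ^ α i) • coeff f α⟫_ℂ := by
  have h1 := (lp.hasSum_inner (𝕜 := ℂ) (toLp (kerL κ E w v)) (toLp f)).tsum_eq
  rw [LinearIsometryEquiv.inner_map_map] at h1
  have h2 := (innerSL ℂ v).hasSum (summable_eval_norm κ f w.2).of_norm.hasSum
  rw [← innerSL_apply_apply ℂ v, ← h2.tsum_eq, ← h1]
  refine tsum_congr fun α => ?_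
  simp only [innerSL_apply_apply, coeff, toLp_kerL,
    inner_smul_left, inner_smul_right, map_mul, Complex.conj_ofReal, Complex.star_def,
    Complex.conj_conj]
  ring

/-- Point evaluation `f ↦ f(w) = ∑_α f_α w^α`. -/
def evalL (w : Ball d) : HK κ d E →L[ℂ] E :=
  (adjoint (kerL κ E w)).copy (fun f => ∑' α : Fin d → ℕ, (∏ i, w.1 i ^ α i) • coeff f α) (by
    ext f
    refine ext_inner_left ℂ fun v => ?_
    rw [← inner_kerL, adjoint_inner_right])

lemma evalL_eq (w : Ball d) : (evalL w : HK κ d E →L[ℂ] E) = adjoint (kerL κ E w) :=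
  ContinuousLinearMap.copy_eq _ _ _

lemma hasSum_evalL (w : Ball d) (f : HK κ d E) :
    HasSum (fun α : Fin d → ℕ => (∏ i, w.1 i ^ α i) • coeff f α) (evalL w f) :=
  (summable_eval_norm κ f w.2).of_norm.hasSum

/-- A power series that vanishes on the ball has only zero coefficients. -/
lemma coeff_eq_zero_of_evalL (f : HK κ d E) (hf : ∀ w : Ball d, evalL w f = 0)
    (β : Fin d → ℕ) : coeff f β = 0 := by
  classical
  -- the homogeneous parts vanish on the ball
  have hom : ∀ (w : Ball d) (n : ℕ),
      ∑ α ∈ Finset.piAntidiag Finset.univ n, (∏ i, w.1 i ^ α i) • coeff f α = 0 := by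
    intro w n
    set q : ℕ → E := fun n =>
      ∑ α ∈ Finset.piAntidiag Finset.univ n, (∏ i, w.1 i ^ α i) • coeff f α with hq
    have hsum : ∀ t : ℂ, ‖t‖ < 1 → HasSum (fun n => t ^ n • q n) 0 := by
      intro t ht
      have hw : ‖w.1‖ < 1 := mem_ball_zero_iff.1 w.2
      have htw : t • w.1 ∈ Ball d := by
        rw [Metric.mem_ball, dist_zero_right, norm_smul]
        have := norm_nonneg t
        have := norm_nonneg w.1
        nlinarith
      have h := hasSum_levels (hasSum_evalL ⟨t • w.1, htw⟩ f)
      rw [hf] at h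
      have h2 : (fun n => t ^ n • q n) = fun n => ∑ α ∈ Finset.piAntidiag Finset.univ n,
          (∏ i, (t • w.1) i ^ α i) • coeff f α := by
        funext n
        rw [hq, Finset.smul_sum]
        refine Finset.sum_congr rfl fun α hα => ?_
        rw [Finset.mem_piAntidiag] at hα
        simp [mul_pow, Finset.prod_mul_distrib, Finset.prod_pow_eq_pow_sum, hα.1, mul_smul]
      rw [h2]
      exact h
    let p : FormalMultilinearSeries ℂ ℂ E := fun n => ContinuousMultilinearMap.mkPiRing ℂ (Fin n) (q n)
    have hp : HasFPowerSeriesAt (0 : ℂ → E) p 0 := by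
      rw [hasFPowerSeriesAt_iff]
      filter_upwards [Metric.ball_mem_nhds (0 : ℂ) one_pos] with t ht
      have := hsum t (mem_ball_zero_iff.1 ht)
      simpa [p, FormalMultilinearSeries.coeff] using this
    have h0 := congrArg (fun p => FormalMultilinearSeries.coeff p n) hp.eq_zero
    simpa [p, FormalMultilinearSeries.coeff] using h0
  refine ext_inner_left ℂ fun v => ?_
  rw [inner_zero_right]
  -- hence they vanish as polynomials
  let P : MvPolynomial (Fin d) ℂ := ∑ α ∈ Finset.piAntidiag Finset.univ (∑ i, β i),
    MvPolynomial.monomial (Finsupp.equivFunOnFinite.symm α) ⟪v, coeff f α⟫_ℂ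
  have hP : P = 0 := by
    refine MvPolynomial.funext_set (fun _ => Metric.ball (0 : ℂ) (1 / (d + 1))) (fun i => ?_)
      fun x hx => ?_
    · exact infinite_of_mem_nhds (0 : ℂ) (Metric.ball_mem_nhds _ (by positivity))
    · have hw : WithLp.toLp 2 x ∈ Ball d := by
        rw [mem_ball_zero_iff, ← sq_lt_one_iff₀ (norm_nonneg _), EuclideanSpace.norm_sq_eq]
        have hx' : ∀ i, ‖x i‖ ^ 2 ≤ 1 / ((d : ℝ) + 1) := fun i => by
          have h1 := (mem_ball_zero_iff.1 (hx i (Set.mem_univ i))).le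
          have h2 : 1 / ((d : ℝ) + 1) ≤ 1 := by
            rw [div_le_one (by positivity)]; linarith [Nat.cast_nonneg (α := ℝ) d]
          have h3 := norm_nonneg (x i)
          nlinarith
        calc ∑ i, ‖x i‖ ^ 2 ≤ ∑ _i : Fin d, 1 / ((d : ℝ) + 1) := Finset.sum_le_sum fun i _ => hx' i
          _ < 1 := by
            rw [Finset.sum_const, Finset.card_univ, Fintype.card_fin, nsmul_eq_mul, mul_one_div,
              div_lt_one (by positivity)]
            linarith
      have := congrArg (fun e => ⟪v, e⟫_ℂ) (hom ⟨_, hw⟩ (∑ i, β i))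
      simp only [inner_sum, inner_smul_right, inner_zero_right] at this
      rw [map_zero, ← this, map_sum]
      refine Finset.sum_congr rfl fun α _ => ?_
      rw [MvPolynomial.eval_monomial, Finsupp.prod_fintype _ _ (by simp), mul_comm]
      rfl
  have hc := congrArg (MvPolynomial.coeff (Finsupp.equivFunOnFinite.symm β)) hP
  rw [MvPolynomial.coeff_sum, Finset.sum_eq_single β] at hc
  · simpa using hc
  · intro α _ hα
    rw [MvPolynomial.coeff_monomial, if_neg]
    simpa using hα
  · intro h
    simp [Finset.mem_piAntidiag] at h

instance : RKHS ℂ (HK κ d E) (Ball d) E where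
  coeCLM := ContinuousLinearMap.pi evalL
  coeCLM_injective := by
    refine (injective_iff_map_eq_zero _).2 fun f hf => ?_
    have h : ∀ β, coeff f β = 0 := coeff_eq_zero_of_evalL f fun w => congrFun hf w
    refine toLp.injective ?_
    ext β
    have := h β
    simp only [coeff, smul_eq_zero, Complex.ofReal_eq_zero] at this
    rcases this with h0 | h0
    · exact absurd h0 (Real.sqrt_pos.2 (κ.weight_pos β)).ne'
    · simpa using h0

lemma apply_eq_tsum (f : HK κ d E) (z : Ball d) :
    f z = ∑' α : Fin d → ℕ, (∏ i, z.1 i ^ α i) • coeff f α := rfl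

lemma hasSum_apply (f : HK κ d E) (z : Ball d) :
    HasSum (fun α : Fin d → ℕ => (∏ i, z.1 i ^ α i) • coeff f α) (f z) := hasSum_evalL z f

/-- The reproducing kernel of `H_K(E)` is `K(z, w) 1_E` with `K(z, w) = k(⟨z, w⟩)`. -/
theorem kernel_eq (z w : Ball d) :
    RKHS.kernel (HK κ d E) z w = κ.k (⟪w.1, z.1⟫_ℂ) • ContinuousLinearMap.id ℂ E := by
  have hk : ∀ v, RKHS.kerFun (HK κ d E) w v = kerL κ E w v := fun v => by
    refine ext_inner_right ℂ fun f => ?_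
    rw [RKHS.kerFun_inner, inner_kerL]; rfl
  ext v
  rw [← RKHS.kerFun_apply, hk]
  have h := hasSum_levels (hasSum_apply (kerL κ E w v) z)
  rw [← h.tsum_eq]
  have hn : ∀ n, ∑ α ∈ Finset.piAntidiag Finset.univ n,
      (∏ i, z.1 i ^ α i) • coeff (kerL κ E w v) α = ((κ.a n : ℂ) * ⟪w.1, z.1⟫_ℂ ^ n) • v := by
    intro n
    have := sum_piAntidiag_weight κ (fun i => z.1 i * star (w.1 i)) n
    simp only [Complex.coe_algebraMap] at this
    rw [show ⟪w.1, z.1⟫_ℂ = ∑ i, z.1 i * star (w.1 i) by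
      simp [PiLp.inner_apply], ← this, Finset.sum_smul]
    refine Finset.sum_congr rfl fun α _ => ?_
    rw [coeff, toLp_kerL, smul_smul, smul_smul]
    congr 1
    have h3 : ((√ (κ.weight α) : ℝ) : ℂ) * ((√ (κ.weight α) : ℝ) : ℂ) = (κ.weight α : ℂ) := by
      rw [← Complex.ofReal_mul, Real.mul_self_sqrt (κ.weight_pos α).le]
    simp only [mul_pow, Finset.prod_mul_distrib, star_prod, star_pow, ← h3]
    ring
  simp_rw [hn]
  have hb : ‖⟪w.1, z.1⟫_ℂ‖ < 1 := by
    have hw : ‖w.1‖ < 1 := mem_ball_zero_iff.1 w.2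
    have hz : ‖z.1‖ < 1 := mem_ball_zero_iff.1 z.2
    have := norm_inner_le_norm (𝕜 := ℂ) w.1 z.1
    have := norm_nonneg z.1
    have := norm_nonneg w.1
    nlinarith
  rw [(κ.summable _ hb).tsum_smul_const]
  rfl

end HK

/-- `γ_α` increases with `α`. -/
lemma multinomial_le_add_single {d : ℕ} (α : Fin d → ℕ) (i : Fin d) :
    Nat.multinomial Finset.univ α ≤ Nat.multinomial Finset.univ (α + Pi.single i 1) := by
  classical
  have h1 := Nat.multinomial_spec Finset.univ α
  have h2 := Nat.multinomial_spec Finset.univ (α + Pi.single i 1)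
  have hs : ∑ j, (α + Pi.single i 1 : Fin d → ℕ) j = ∑ j, α j + 1 := by
    simp [Finset.sum_add_distrib]
  have hp : ∏ j, ((α + Pi.single i 1 : Fin d → ℕ) j).factorial = (α i + 1) * ∏ j, (α j).factorial := by
    rw [← Finset.mul_prod_erase _ _ (Finset.mem_univ i),
      ← Finset.mul_prod_erase _ (fun j => (α j).factorial) (Finset.mem_univ i), ← mul_assoc]
    congr 1
    · simp [Nat.factorial_succ]
    · refine Finset.prod_congr rfl fun j hj => ?_
      simp [Finset.ne_of_mem_erase hj]
  rw [hs, hp, Nat.factorial_succ, ← h1] at h2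
  have hP : 0 < ∏ j, (α j).factorial := Finset.prod_pos fun j _ => Nat.factorial_pos _
  have hle : α i ≤ ∑ j, α j := Finset.single_le_sum (fun _ _ => Nat.zero_le _) (Finset.mem_univ i)
  have h3 : (α i + 1) * Nat.multinomial Finset.univ (α + Pi.single i 1)
      = (∑ j, α j + 1) * Nat.multinomial Finset.univ α := by
    refine Nat.eq_of_mul_eq_mul_left hP ?_
    linarith [h2]
  have h4 : (α i + 1) * Nat.multinomial Finset.univ α ≤
      (α i + 1) * Nat.multinomial Finset.univ (α + Pi.single i 1) := by
    rw [h3]; gcongr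
  exact Nat.le_of_mul_le_mul_left h4 (Nat.succ_pos _)

lemma KernelSeries.weight_le (κ : KernelSeries) {d : ℕ} (α : Fin d → ℕ) (i : Fin d) :
    κ.weight α ≤ (⨆ n, κ.a n / κ.a (n + 1)) * κ.weight (α + Pi.single i 1) := by
  have h1 : κ.a (∑ j, α j) / κ.a (∑ j, α j + 1) ≤ ⨆ n, κ.a n / κ.a (n + 1) :=
    le_ciSup κ.sup_finite _
  rw [div_le_iff₀ (κ.a_pos _)] at h1
  have h2 : (Nat.multinomial Finset.univ α : ℝ) ≤ Nat.multinomial Finset.univ (α + Pi.single i 1) := by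
    exact_mod_cast multinomial_le_add_single α i
  have hs : ∑ j, (α + Pi.single i 1 : Fin d → ℕ) j = ∑ j, α j + 1 := by
    simp [Finset.sum_add_distrib]
  rw [weight, weight, hs, ← mul_assoc]
  exact mul_le_mul h1 h2 (by positivity) ((κ.a_pos _).le.trans h1)

lemma KernelSeries.ratio_le (κ : KernelSeries) (n : ℕ) :
    κ.a (n + 1) / κ.a n ≤ (⨅ n, κ.a n / κ.a (n + 1))⁻¹ := by
  have h : ⨅ n, κ.a n / κ.a (n + 1) ≤ κ.a n / κ.a (n + 1) :=
    ciInf_le ⟨0, by rintro _ ⟨m, rfl⟩; exact (div_pos (κ.a_pos _) (κ.a_pos _)).le⟩ n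
  rw [← inv_div]
  exact inv_anti₀ κ.inf_pos h

lemma sub_single_add {d : ℕ} {β : Fin d → ℕ} {i : Fin d} (h : β i ≠ 0) :
    β - Pi.single i 1 + Pi.single i 1 = β := by
  funext j
  rcases eq_or_ne j i with rfl | hj
  · simp only [Pi.add_apply, Pi.sub_apply, Pi.single_eq_same]; omega
  · simp [hj]

namespace HK

variable {κ : KernelSeries} {d : ℕ} {E : Type*} [NormedAddCommGroup E] [InnerProductSpace ℂ E]

lemma sum_norm_sq_le (f : HK κ d E) (s : Finset (Fin d → ℕ)) :
    ∑ α ∈ s, ‖toLp f α‖ ^ 2 ≤ ‖f‖ ^ 2 := by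
  simpa using lp.sum_rpow_le_norm_rpow (by simp) (toLp f) s

/-- The coordinate with index `α` as a linear map. -/
def coord (α : Fin d → ℕ) : HK κ d E →ₗ[ℂ] E where
  toFun f := toLp f α
  map_add' f g := by simp
  map_smul' c f := by simp

lemma coord_apply (α : Fin d → ℕ) (f : HK κ d E) : coord α f = toLp f α := rfl

/-- Multiplication by the coordinate function `z_i` on `H_K(E)` (see `Mz_apply`); in Taylor
coefficients it is the shift `(z_i f)_β = f_{β - e_i}`. -/
def Mz (κ : KernelSeries) {d : ℕ} (E : Type*) [NormedAddCommGroup E] [InnerProductSpace ℂ E]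
    (i : Fin d) : HK κ d E →L[ℂ] HK κ d E :=
  toLp.symm.toContinuousLinearEquiv.toContinuousLinearMap ∘L
    lpMk (fun β => if β i = 0 then 0 else
        ((√ (κ.weight (β - Pi.single i 1) / κ.weight β) : ℝ) : ℂ) •
          (coord (β - Pi.single i 1)))
      (⨆ n, κ.a n / κ.a (n + 1)) (fun f s => by
        classical
        rw [← Finset.sum_filter_add_sum_filter_not s (fun β => β i = 0)]
        have h0 : ∑ β ∈ s with β i = 0, ‖(if β i = 0 then (0 : HK κ d E →ₗ[ℂ] E) else
            ((√ (κ.weight (β - Pi.single i 1) / κ.weight β) : ℝ) : ℂ) •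
              coord (β - Pi.single i 1)) f‖ ^ 2 = 0 :=
          Finset.sum_eq_zero fun β hβ => by simp [(Finset.mem_filter.1 hβ).2]
        rw [h0, zero_add]
        have hC : 0 ≤ ⨆ n, κ.a n / κ.a (n + 1) :=
          Real.iSup_nonneg fun n => (div_pos (κ.a_pos _) (κ.a_pos _)).le
        have hinj : Set.InjOn (fun β : Fin d → ℕ => β - Pi.single i 1)
            (s.filter fun β => ¬ β i = 0) := by
          intro β hβ β' hβ' h
          have e1 := (Finset.mem_filter.1 hβ).2
          have e2 := (Finset.mem_filter.1 hβ').2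
          rw [← sub_single_add e1, ← sub_single_add e2]
          exact congrArg (· + Pi.single i 1) h
        refine le_trans ?_ (mul_le_mul_of_nonneg_left
          (sum_norm_sq_le f ((s.filter fun β => ¬ β i = 0).image fun β => β - Pi.single i 1)) hC)
        rw [Finset.sum_image hinj, Finset.mul_sum]
        refine Finset.sum_le_sum fun β hβ => ?_
        have e1 := (Finset.mem_filter.1 hβ).2
        rw [if_neg e1, LinearMap.smul_apply, norm_smul, mul_pow, Complex.norm_real,
          Real.norm_eq_abs, sq_abs,
          Real.sq_sqrt (div_pos (κ.weight_pos _) (κ.weight_pos _)).le, coord_apply]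
        gcongr
        rw [div_le_iff₀ (κ.weight_pos _)]
        have := κ.weight_le (β - Pi.single i 1) i
        rwa [sub_single_add e1] at this)

lemma coeff_Mz (i : Fin d) (f : HK κ d E) (β : Fin d → ℕ) :
    coeff (Mz κ E i f) β = if β i = 0 then 0 else coeff f (β - Pi.single i 1) := by
  have h : toLp (Mz κ E i f) β = (if β i = 0 then (0 : HK κ d E →ₗ[ℂ] E) else
      ((√ (κ.weight (β - Pi.single i 1) / κ.weight β) : ℝ) : ℂ) •
        coord (β - Pi.single i 1)) f := rfl
  rw [coeff, h]
  split_ifs with hβ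
  · simp
  · rw [LinearMap.smul_apply, coord_apply, coeff, smul_smul, ← Complex.ofReal_mul,
      ← Real.sqrt_mul (κ.weight_pos _).le, mul_div_cancel₀ _ (κ.weight_pos β).ne']

/-- The diagonal operator `Δ`: it multiplies the Taylor coefficients of order `n` with
`a_{n+1} / a_n`. -/
def Delta (κ : KernelSeries) (d : ℕ) (E : Type*) [NormedAddCommGroup E] [InnerProductSpace ℂ E] :
    HK κ d E →L[ℂ] HK κ d E :=
  toLp.symm.toContinuousLinearEquiv.toContinuousLinearMap ∘L
    lpMk (fun α => ((κ.a (∑ i, α i + 1) / κ.a (∑ i, α i) : ℝ) : ℂ) •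
          coord α)
      ((⨅ n, κ.a n / κ.a (n + 1))⁻¹ ^ 2) (fun f s => by
        have h0 : 0 ≤ (⨅ n, κ.a n / κ.a (n + 1))⁻¹ ^ 2 := sq_nonneg _
        refine le_trans ?_ (mul_le_mul_of_nonneg_left (sum_norm_sq_le f s) h0)
        rw [Finset.mul_sum]
        refine Finset.sum_le_sum fun α _ => ?_
        rw [LinearMap.smul_apply, norm_smul, mul_pow, Complex.norm_real, Real.norm_eq_abs,
          sq_abs, coord_apply]
        gcongr
        · exact (div_pos (κ.a_pos _) (κ.a_pos _)).le
        · exact κ.ratio_le _)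

lemma coeff_Delta (f : HK κ d E) (α : Fin d → ℕ) :
    coeff (Delta κ d E f) α = ((κ.a (∑ i, α i + 1) / κ.a (∑ i, α i) : ℝ) : ℂ) • coeff f α := by
  have h : toLp (Delta κ d E f) α =
      ((κ.a (∑ i, α i + 1) / κ.a (∑ i, α i) : ℝ) : ℂ) • toLp f α := rfl
  rw [coeff, coeff, h, smul_comm]

variable [CompleteSpace E]

/-- `(z_i f)(z) = z_i f(z)`. -/
theorem Mz_apply (i : Fin d) (f : HK κ d E) (z : Ball d) : Mz κ E i f z = z.1 i • f z := by
  have h := (hasSum_apply f z).const_smul (z.1 i)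
  refine (hasSum_apply (Mz κ E i f) z).unique ?_
  have hinj : Function.Injective fun α : Fin d → ℕ => α + Pi.single i 1 :=
    add_left_injective _
  rw [← hinj.hasSum_iff]
  · convert! h using 2 with α
    simp only [Function.comp_apply, coeff_Mz]
    rw [if_neg (by simp), add_tsub_cancel_right, smul_smul]
    congr 1
    simp only [Pi.add_apply, pow_add, Finset.prod_mul_distrib]
    rw [mul_comm]
    congr 1
    rw [Finset.prod_eq_single i]
    · simp
    · intro j _ hj; simp [hj]
    · simp
  · intro β hβ
    rw [coeff_Mz, if_pos, smul_zero]
    by_contra h0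
    exact hβ ⟨β - Pi.single i 1, sub_single_add h0⟩

end HK

/-! ### Operator tuples -/

section Tuples

variable {d : ℕ} {H : Type*} [NormedAddCommGroup H] [InnerProductSpace ℂ H]

/-- The power `S^α = S_1^{α_1} ⋯ S_d^{α_d}` of a commuting tuple. -/
def tuplePow (S : Fin d → H →L[ℂ] H) (α : Fin d → ℕ) : H →L[ℂ] H :=
  (List.ofFn fun i => S i ^ α i).prod

/-- The row operator `H^d → H`, `(h_i) ↦ ∑ S_i h_i`. -/
def row (S : Fin d → H →L[ℂ] H) : PiLp 2 (fun _ : Fin d => H) →L[ℂ] H :=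
  ∑ i, S i ∘L PiLp.proj 2 (fun _ : Fin d => H) i

/-- The operator `⊕ X : H^d → G^d`. -/
def oplus (d : ℕ) {G : Type*} [NormedAddCommGroup G] [InnerProductSpace ℂ G] (X : H →L[ℂ] G) :
    PiLp 2 (fun _ : Fin d => H) →L[ℂ] PiLp 2 (fun _ : Fin d => G) :=
  (PiLp.continuousLinearEquiv 2 ℂ (fun _ : Fin d => G)).symm.toContinuousLinearMap ∘L
    ContinuousLinearMap.pi fun i => X ∘L PiLp.proj 2 (fun _ : Fin d => H) i

@[simp]
lemma row_apply (S : Fin d → H →L[ℂ] H) (h : PiLp 2 (fun _ : Fin d => H)) :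
    row S h = ∑ i, S i (h i) := by
  simp [row]

@[simp]
lemma oplus_apply {G : Type*} [NormedAddCommGroup G] [InnerProductSpace ℂ G] (X : H →L[ℂ] G)
    (h : PiLp 2 (fun _ : Fin d => H)) (i : Fin d) : oplus d X h i = X (h i) := rfl

variable [CompleteSpace H]

/-- `σ_T(X) = ∑ T_i X T_i^*`. -/
def sigma (T : Fin d → H →L[ℂ] H) (X : H →L[ℂ] H) : H →L[ℂ] H :=
  ∑ i, T i ∘L X ∘L adjoint (T i)

/-- `σ_T^n(X) = ∑_{|α| = n} γ_α T^α X T^{*α}` for a commuting tuple. -/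
lemma sigma_iterate (T : Fin d → H →L[ℂ] H) (hT : ∀ i j, Commute (T i) (T j)) (n : ℕ)
    (X : H →L[ℂ] H) :
    (sigma T)^[n] X = ∑ α ∈ Finset.piAntidiag Finset.univ n,
      (Nat.multinomial Finset.univ α : ℂ) • (tuplePow T α ∘L X ∘L adjoint (tuplePow T α)) := by
  let S : Fin d → Module.End ℂ (H →L[ℂ] H) := fun i =>
    { toFun := fun X => T i ∘L X ∘L adjoint (T i)
      map_add' := fun X Y => by ext; simp
      map_smul' := fun c X => by ext; simp }
  have hS : ∀ i j, Commute (S i) (S j) := fun i j => by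
    refine LinearMap.ext fun X => ?_
    have h1 : T i * T j = T j * T i := hT i j
    have h2 : adjoint (T j) * adjoint (T i) = adjoint (T i) * adjoint (T j) := by
      simpa [← star_eq_adjoint, star_mul] using congrArg star h1
    change T i * (T j * (X * adjoint (T j)) * adjoint (T i)) =
      T j * (T i * (X * adjoint (T i)) * adjoint (T j))
    calc T i * (T j * (X * adjoint (T j)) * adjoint (T i))
        = (T i * T j) * X * (adjoint (T j) * adjoint (T i)) := by simp only [mul_assoc]
      _ = (T j * T i) * X * (adjoint (T i) * adjoint (T j)) := by rw [h1, h2]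
      _ = _ := by simp only [mul_assoc]
  have hpow : ∀ (i : Fin d) (m : ℕ) (X : H →L[ℂ] H),
      (S i ^ m) X = T i ^ m * X * adjoint (T i ^ m) := by
    intro i m
    induction m with
    | zero => intro X; simp [← star_eq_adjoint]
    | succ m ih =>
      intro X
      rw [pow_succ', Module.End.mul_apply, ih, pow_succ']
      change T i * (T i ^ m * X * adjoint (T i ^ m) * adjoint (T i)) = _
      simp only [← star_eq_adjoint, star_mul, mul_assoc]
  have hprod : ∀ (l : List (Fin d)) (α : Fin d → ℕ) (X : H →L[ℂ] H),
      (l.map fun i => S i ^ α i).prod X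
        = (l.map fun i => T i ^ α i).prod * X * adjoint (l.map fun i => T i ^ α i).prod := by
    intro l α
    induction l with
    | nil => intro X; simp [← star_eq_adjoint]
    | cons i l ih =>
      intro X
      simp only [List.map_cons, List.prod_cons, Module.End.mul_apply, ih, hpow]
      simp only [← star_eq_adjoint, star_mul, mul_assoc]
  have h1 : (sigma T)^[n] X = ((∑ i, S i) ^ n) X := by
    rw [Module.End.pow_apply]
    congr 2
    funext X
    simp [sigma, S, LinearMap.sum_apply]
  rw [h1, Finset.sum_pow_eq_sum_piAntidiag_of_commute _ _ (fun i _ j _ _ => hS i j),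
    LinearMap.sum_apply]
  refine Finset.sum_congr rfl fun α _ => ?_
  have h2 : Finset.noncommProd Finset.univ (fun i => S i ^ α i)
      (fun i _ j _ _ => (hS i j).pow_pow _ _) = ((List.finRange d).map fun i => S i ^ α i).prod :=
    Multiset.noncommProd_coe _ _
  rw [h2, ← nsmul_eq_mul, LinearMap.smul_apply, hprod, tuplePow, List.ofFn_eq_map,
    ← Nat.cast_smul_eq_nsmul ℂ]
  rfl

/-- A `K`-contraction: a commuting tuple such that `1/K(T) = SOT-∑ c_n σ_T^n(1)` exists and is
positive. -/
structure IsKContraction (κ : KernelSeries) (T : Fin d → H →L[ℂ] H) : Prop where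
  comm : ∀ i j, Commute (T i) (T j)
  exists_defect : ∃ X : H →L[ℂ] H, X.IsPositive ∧ ∀ h : H,
    Tendsto (fun N => ∑ n ∈ Finset.range N, κ.c n • (sigma T)^[n] 1 h) atTop (𝓝 (X h))

/-- The operator `1/K(T)` of a `K`-contraction. -/
def IsKContraction.defect {κ : KernelSeries} {T : Fin d → H →L[ℂ] H} (hT : IsKContraction κ T) :
    H →L[ℂ] H := hT.exists_defect.choose

lemma IsKContraction.defect_isPositive {κ : KernelSeries} {T : Fin d → H →L[ℂ] H}
    (hT : IsKContraction κ T) : hT.defect.IsPositive := hT.exists_defect.choose_spec.1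

lemma IsKContraction.tendsto_defect {κ : KernelSeries} {T : Fin d → H →L[ℂ] H}
    (hT : IsKContraction κ T) (h : H) :
    Tendsto (fun N => ∑ n ∈ Finset.range N, κ.c n • (sigma T)^[n] 1 h) atTop
      (𝓝 (hT.defect h)) := hT.exists_defect.choose_spec.2 h

/-- A pure `K`-contraction: `SOT-lim_N 1 - ∑_{n ≤ N} a_n σ_T^n(1/K(T)) = 0`. -/
structure IsPureKContraction (κ : KernelSeries) (T : Fin d → H →L[ℂ] H) : Prop
    extends IsKContraction κ T where
  pure : ∀ h : H, Tendsto
    (fun N => h - ∑ n ∈ Finset.range (N + 1), (κ.a n : ℂ) • (sigma T)^[n] toIsKContraction.defect h)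
    atTop (𝓝 0)

namespace IsPureKContraction

variable {κ : KernelSeries} {T : Fin d → H →L[ℂ] H}
variable {E : Type*} [NormedAddCommGroup E] [InnerProductSpace ℂ E] [CompleteSpace E]

lemma sum_level (hT : IsPureKContraction κ T) (C : H →L[ℂ] E)
    (hC : adjoint C ∘L C = hT.defect) (n : ℕ) (h : H) :
    ∑ α ∈ Finset.piAntidiag Finset.univ n, κ.weight α * ‖C (adjoint (tuplePow T α) h)‖ ^ 2
      = RCLike.re ⟪(κ.a n : ℂ) • (sigma T)^[n] hT.defect h, h⟫_ℂ := by
  rw [sigma_iterate T hT.comm, sum_apply, Finset.smul_sum, sum_inner, map_sum]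
  refine Finset.sum_congr rfl fun α hα => ?_
  rw [Finset.mem_piAntidiag] at hα
  rw [← hC]
  simp only [smul_apply, ContinuousLinearMap.comp_apply, inner_smul_left,
    ← adjoint_inner_right (tuplePow T α), adjoint_inner_left, inner_self_eq_norm_sq_to_K]
  simp only [Complex.conj_ofReal, map_natCast, KernelSeries.weight, hα.1]
  norm_cast
  rw [mul_assoc]
  simp only [RCLike.re_eq_complex_re, Complex.re_ofReal_mul, ← Complex.ofReal_natCast]
  rfl

lemma sum_le (hT : IsPureKContraction κ T) (C : H →L[ℂ] E)
    (hC : adjoint C ∘L C = hT.defect) (h : H) (s : Finset (Fin d → ℕ)) :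
    ∑ α ∈ s, κ.weight α * ‖C (adjoint (tuplePow T α) h)‖ ^ 2 ≤ ‖h‖ ^ 2 := by
  obtain ⟨N₀, hN₀⟩ := sum_le_sum_levels
    (fun α : Fin d → ℕ => κ.weight α * ‖C (adjoint (tuplePow T α) h)‖ ^ 2)
    (fun α => mul_nonneg (κ.weight_pos α).le (sq_nonneg _)) s
  have h1 : Tendsto (fun N => ∑ n ∈ Finset.range (N + 1), (κ.a n : ℂ) •
      (sigma T)^[n] hT.defect h) atTop (𝓝 h) := by
    simpa using (hT.pure h).const_sub h
  have h2 := (((innerSL ℂ).flip h).continuous.tendsto h).comp h1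
  have h3 := (Complex.continuous_re.tendsto _).comp h2
  have h4 : Complex.re (((innerSL ℂ).flip h) h) = ‖h‖ ^ 2 := by
    simp [inner_self_eq_norm_sq_to_K, ← Complex.ofReal_pow]
  rw [h4] at h3
  refine ge_of_tendsto h3 ?_
  filter_upwards [eventually_ge_atTop N₀] with N hN
  refine (hN₀ (N + 1) (by omega)).trans (le_of_eq ?_)
  simp only [Function.comp_apply, map_sum, Complex.re_sum]
  refine Finset.sum_congr rfl fun n _ => ?_
  rw [hT.sum_level C hC]
  rfl

/-- The dilation `j_C : H → H_K(E)`, `j_C(h) = ∑_α a_{|α|} γ_α (C T^{*α} h) z^α`, for an operator `C`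
with `C^* C = 1/K(T)` (see `coeff_dilation`). -/
def dilation (hT : IsPureKContraction κ T) (C : H →L[ℂ] E)
    (hC : adjoint C ∘L C = hT.defect) : H →L[ℂ] HK κ d E :=
  HK.toLp.symm.toContinuousLinearEquiv.toContinuousLinearMap ∘L
    lpMk (fun α => ((√ (κ.weight α) : ℝ) : ℂ) • (C ∘L adjoint (tuplePow T α)).toLinearMap) 1
      (fun h s => by
        rw [one_mul]
        refine le_trans (le_of_eq ?_) (hT.sum_le C hC h s)
        refine Finset.sum_congr rfl fun α _ => ?_
        rw [LinearMap.smul_apply, norm_smul, mul_pow, Complex.norm_real, Real.norm_eq_abs,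
          sq_abs, Real.sq_sqrt (κ.weight_pos α).le]
        rfl)

lemma coeff_dilation (hT : IsPureKContraction κ T) (C : H →L[ℂ] E)
    (hC : adjoint C ∘L C = hT.defect) (h : H) (α : Fin d → ℕ) :
    HK.coeff (hT.dilation C hC h) α = (κ.weight α : ℂ) • C (adjoint (tuplePow T α) h) := by
  have h1 : HK.toLp (hT.dilation C hC h) α =
      ((√ (κ.weight α) : ℝ) : ℂ) • C (adjoint (tuplePow T α) h) := rfl
  rw [HK.coeff, h1, smul_smul, ← Complex.ofReal_mul, Real.mul_self_sqrt (κ.weight_pos α).le]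

/-- The positive square root of `1/K(T)`. -/
def sqrtDefect (hT : IsPureKContraction κ T) : H →L[ℂ] H := CFC.sqrt hT.defect

/-- The defect space `closure (Im (1/K(T))^{1/2})`. -/
abbrev defectSpace (hT : IsPureKContraction κ T) : Submodule ℂ H :=
  (LinearMap.range hT.sqrtDefect.toLinearMap).topologicalClosure

/-- `(1/K(T))^{1/2}` as an operator from `H` to the defect space. -/
def defectOp (hT : IsPureKContraction κ T) : H →L[ℂ] hT.defectSpace :=
  hT.sqrtDefect.codRestrict hT.defectSpace fun h =>
    Submodule.le_topologicalClosure _ (LinearMap.mem_range_self _ h)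

lemma adjoint_defectOp_comp (hT : IsPureKContraction κ T) :
    adjoint hT.defectOp ∘L hT.defectOp = hT.defect := by
  have h0 : (0 : H →L[ℂ] H) ≤ hT.defect :=
    (ContinuousLinearMap.nonneg_iff_isPositive _).2 hT.defect_isPositive
  have hs : adjoint hT.sqrtDefect = hT.sqrtDefect :=
    (IsSelfAdjoint.of_nonneg (CFC.sqrt_nonneg hT.defect)).adjoint_eq
  ext h
  refine ext_inner_right ℂ fun g => ?_
  rw [ContinuousLinearMap.comp_apply, adjoint_inner_left]
  change ⟪hT.sqrtDefect h, hT.sqrtDefect g⟫_ℂ = _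
  rw [← adjoint_inner_left, hs, ← CFC.sqrt_mul_sqrt_self hT.defect h0]
  rfl

/-- The canonical dilation `j : H → H_K(𝒟)` into the space over the defect space. -/
def canonicalDilation (hT : IsPureKContraction κ T) : H →L[ℂ] HK κ d hT.defectSpace :=
  hT.dilation hT.defectOp hT.adjoint_defectOp_comp

/-- `Δ_T = j^* Δ j`. -/
def DeltaT (hT : IsPureKContraction κ T) : H →L[ℂ] H :=
  adjoint hT.canonicalDilation ∘L HK.Delta κ d hT.defectSpace ∘L hT.canonicalDilation

end IsPureKContraction

/-- The operator `F(X) = ∑ a_{n+1} X^n` for `F(z) = ∑ a_{n+1} z^n = (k(z) - 1) / z`. -/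
def KernelSeries.F (κ : KernelSeries) (X : H →L[ℂ] H) : H →L[ℂ] H :=
  ∑' n, (κ.a (n + 1) : ℂ) • X ^ n

end Tuples

/-- A `K`-inner function on the unit ball: an analytic operator-valued function `W` such that
`x ↦ W x` is a well-defined isometry into `H_K(E)` and `W E_* ⟂ M_z^α (W E_*)` for all
`α ≠ 0`. -/
structure IsKInner (κ : KernelSeries) {d : ℕ} {E Estar : Type*}
    [NormedAddCommGroup E] [InnerProductSpace ℂ E] [CompleteSpace E]
    [NormedAddCommGroup Estar] [InnerProductSpace ℂ Estar]
    (W : EuclideanSpace ℂ (Fin d) → Estar →L[ℂ] E) : Prop where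
  analytic : AnalyticOnNhd ℂ W (Ball d)
  wandering : ∃ V : Estar →ₗᵢ[ℂ] HK κ d E, (∀ x (z : Ball d), V x z = W z x) ∧
    ∀ α : Fin d → ℕ, α ≠ 0 → ∀ x y, ⟪V x, tuplePow (HK.Mz κ E) α (V y)⟫_ℂ = 0

end KInner

end

/-!
Write `j = j_C` for the dilation and `const` for the embedding of `E` into `H_K(E)` as constant
functions. Grouping `F(Z T^*) = ∑ aₙ₊₁ (Z T^*)ⁿ` by multi-indices gives
`C F(Z T^*) h = (Δ j h)(z)` (`Delta_dilation_apply`), so `W x` is the function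
`const (D x) + M_z (⊕ Δ j) B x` (`transfer_apply`). The rest uses two identities on `H_K(E)`:
`M_{z_i}^* j = j T_i^*` (`adjoint_Mz_dilation`), and the fact that `M_z (⊕ Δ) M_z^*` is the
projection onto the functions vanishing at `0` (`sum_Mz_Delta_adjoint_Mz`).

* By (K4), `(⊕ j) B x = M_z^* f` for some `f`. Hence `W x = const (D x) + f - const (f 0)`, and
  `M_z^* (W x) = M_z^* f = (⊕ j) B x`, since `M_z^*` annihilates constants.
* Therefore `⟨W x, W x⟩ = ⟨D x, D x⟩ + ⟨M_z^* W x, (⊕ Δ j) B x⟩`, and the last term is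
  `⟨B x, (⊕ Δ_T) B x⟩`, because `j_C^* Δ j_C` depends on `C^* C` only and so equals `Δ_T`. Now (K3)
  says that `x ↦ W x` is isometric.
* By the same computation, (K2) says that `W E_*` is orthogonal to the range of `j`. This range is
  invariant under `M_z^*` and contains all `M_{z_i}^* (W x)`, so `W E_* ⟂ M_z^α (W E_*)` for
  `α ≠ 0`.

It remains to see that `F(Z T^*)` converges and is analytic on the ball, where the norm of `Z T^*`
gives no control. The Cauchy-Schwarz inequality bounds a product `Z_1 T^* ⋯ Z_n T^*` by
`‖Z_1‖ ⋯ ‖Z_n‖ ‖σ_T^n(1)‖^{1/2}` (`norm_prod_pencil_sq_le`), and purity gives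
`σ_T^n(1) ≤ sup_m (aₘ / aₘ₊ₙ)` (`re_inner_sigma_iterate_one_le`). If `aₙ / aₙ₊₁ → r`, then `r ≥ 1`
and the supremum is `O(ρⁿ)` for each `ρ > r`, which makes the radius of convergence of the
multilinear power series of `z ↦ F(Z T^*)` at least `1` (`one_le_radius`).
-/

noncomputable section

namespace KInner

/-! ### Multi-indices and powers of commuting tuples -/

/-- A multi-index is built up from `0` by adding unit vectors. -/
lemma multiIndex_induction {d : ℕ} {p : (Fin d → ℕ) → Prop} (zero : p 0)
    (add_single : ∀ α i, p α → p (α + Pi.single i 1)) (α : Fin d → ℕ) : p α := by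
  induction hn : ∑ i, α i generalizing α with
  | zero =>
    have : α = 0 := by
      funext i
      simpa using (Finset.sum_eq_zero_iff.1 hn) i (Finset.mem_univ i)
    rwa [this]
  | succ n ih =>
    obtain ⟨i, hi⟩ : ∃ i, α i ≠ 0 := by
      by_contra! h
      simp [h] at hn
    rw [← sub_single_add hi]
    refine add_single _ _ (ih _ ?_)
    have h1 : ∑ j, (α - Pi.single i 1 + Pi.single i 1 : Fin d → ℕ) j = n + 1 := by
      rw [sub_single_add hi, hn]
    simpa [Finset.sum_add_distrib] using h1

lemma sum_add_single {d : ℕ} (α : Fin d → ℕ) (i : Fin d) :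
    ∑ j, (α + Pi.single i 1 : Fin d → ℕ) j = ∑ j, α j + 1 := by
  simp [Finset.sum_add_distrib]

/-- `(αᵢ + 1) γ_{α + eᵢ} = (|α| + 1) γ_α`. -/
lemma succ_mul_multinomial_add_single {d : ℕ} (α : Fin d → ℕ) (i : Fin d) :
    (α i + 1) * Nat.multinomial Finset.univ (α + Pi.single i 1)
      = (∑ j, α j + 1) * Nat.multinomial Finset.univ α := by
  have h1 := Nat.multinomial_spec Finset.univ α
  have h2 := Nat.multinomial_spec Finset.univ (α + Pi.single i 1)
  have hp : ∏ j, ((α + Pi.single i 1 : Fin d → ℕ) j).factorial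
      = (α i + 1) * ∏ j, (α j).factorial := by
    rw [← Finset.mul_prod_erase _ _ (Finset.mem_univ i),
      ← Finset.mul_prod_erase _ (fun j => (α j).factorial) (Finset.mem_univ i), ← mul_assoc]
    congr 1
    · simp [Nat.factorial_succ]
    · refine Finset.prod_congr rfl fun j hj => ?_
      simp [Finset.ne_of_mem_erase hj]
  rw [sum_add_single, hp, Nat.factorial_succ, ← h1] at h2
  have hP : 0 < ∏ j, (α j).factorial := Finset.prod_pos fun j _ => Nat.factorial_pos _
  refine Nat.eq_of_mul_eq_mul_left hP ?_
  linarith [h2]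

lemma KernelSeries.weight_zero (κ : KernelSeries) (d : ℕ) : κ.weight (0 : Fin d → ℕ) = 1 := by
  simp [KernelSeries.weight, κ.a_zero, Nat.multinomial]

section Tuples

variable {d : ℕ} {H : Type*} [NormedAddCommGroup H] [InnerProductSpace ℂ H]

lemma pairwise_commute_pow {S : Fin d → H →L[ℂ] H} (hS : ∀ i j, Commute (S i) (S j))
    (α : Fin d → ℕ) :
    ((Finset.univ : Finset (Fin d)) : Set (Fin d)).Pairwise
      (Function.onFun Commute fun i => S i ^ α i) :=
  fun i _ j _ _ => (hS i j).pow_pow _ _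

lemma tuplePow_eq_noncommProd (S : Fin d → H →L[ℂ] H) (hS : ∀ i j, Commute (S i) (S j))
    (α : Fin d → ℕ) :
    tuplePow S α = Finset.noncommProd Finset.univ (fun i => S i ^ α i)
      (pairwise_commute_pow hS α) := by
  rw [tuplePow, List.ofFn_eq_map]
  exact (Multiset.noncommProd_coe _ _).symm

@[simp]
lemma tuplePow_zero (S : Fin d → H →L[ℂ] H) : tuplePow S 0 = 1 := by
  simp [tuplePow]

lemma tuplePow_add_single (S : Fin d → H →L[ℂ] H) (hS : ∀ i j, Commute (S i) (S j))
    (α : Fin d → ℕ) (i : Fin d) :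
    tuplePow S (α + Pi.single i 1) = S i * tuplePow S α := by
  classical
  rw [tuplePow_eq_noncommProd S hS, tuplePow_eq_noncommProd S hS,
    ← Finset.mul_noncommProd_erase _ (Finset.mem_univ i),
    ← Finset.mul_noncommProd_erase _ (Finset.mem_univ i) (fun i => S i ^ α i), ← mul_assoc]
  congr 1
  · simp [pow_succ']
  · refine Finset.noncommProd_congr rfl (fun j hj => ?_) _
    simp [Finset.ne_of_mem_erase hj]

lemma tuplePow_smul (S : Fin d → H →L[ℂ] H) (hS : ∀ i j, Commute (S i) (S j))
    (z : Fin d → ℂ) (α : Fin d → ℕ) :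
    tuplePow (fun i => z i • S i) α = (∏ i, z i ^ α i) • tuplePow S α := by
  have hzS : ∀ i j, Commute (z i • S i) (z j • S j) := fun i j =>
    ((hS i j).smul_left _).smul_right _
  induction α using multiIndex_induction with
  | zero => simp
  | add_single α i ih =>
    rw [tuplePow_add_single _ hzS, tuplePow_add_single _ hS, ih, smul_mul_smul_comm]
    congr 1
    simp only [Pi.add_apply, pow_add, Finset.prod_mul_distrib]
    rw [mul_comm]
    congr 1
    rw [Finset.prod_eq_single i]
    · simp
    · intro j _ hj; simp [hj]
    · simp

variable [CompleteSpace H]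

lemma commute_adjoint {S : Fin d → H →L[ℂ] H} (hS : ∀ i j, Commute (S i) (S j)) (i j : Fin d) :
    Commute (adjoint (S i)) (adjoint (S j)) := (hS i j).star_star

lemma adjoint_tuplePow (S : Fin d → H →L[ℂ] H) (hS : ∀ i j, Commute (S i) (S j))
    (α : Fin d → ℕ) : adjoint (tuplePow S α) = tuplePow (fun i => adjoint (S i)) α := by
  induction α using multiIndex_induction with
  | zero => simp [← star_eq_adjoint]
  | add_single α i ih =>
    have hc : Commute (S i) (tuplePow S α) := by
      rw [tuplePow_eq_noncommProd S hS]
      exact Finset.noncommProd_commute _ _ _ _ fun j _ => (hS i j).pow_right _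
    rw [tuplePow_add_single _ hS, tuplePow_add_single _ (commute_adjoint hS), ← ih, hc.eq]
    exact star_mul _ _

lemma adjoint_tuplePow_add_single (S : Fin d → H →L[ℂ] H) (hS : ∀ i j, Commute (S i) (S j))
    (α : Fin d → ℕ) (i : Fin d) (h : H) :
    adjoint (tuplePow S (α + Pi.single i 1)) h = adjoint (tuplePow S α) (adjoint (S i) h) := by
  rw [tuplePow_add_single S hS]
  exact congrArg (fun X : H →L[ℂ] H => X h) (star_mul (S i) (tuplePow S α))

lemma adjoint_row_apply (S : Fin d → H →L[ℂ] H) (h : H) (i : Fin d) :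
    adjoint (row S) h i = adjoint (S i) h := by
  classical
  refine ext_inner_left ℂ fun g => ?_
  have h1 : ⟪(WithLp.toLp 2 (Pi.single i g) : PiLp 2 fun _ : Fin d => H), adjoint (row S) h⟫_ℂ
      = ⟪g, adjoint (row S) h i⟫_ℂ := by
    rw [PiLp.inner_apply, Finset.sum_eq_single i]
    · simp
    · intro j _ hj; simp [hj]
    · simp
  rw [← h1, adjoint_inner_right, adjoint_inner_right, row_apply, Finset.sum_eq_single i]
  · simp
  · intro j _ hj; simp [hj]
  · simp

end Tuples

/-! ### The shift and its adjoint in coordinates -/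

namespace HK

variable {κ : KernelSeries} {d : ℕ} {E : Type*} [NormedAddCommGroup E] [InnerProductSpace ℂ E]

lemma toLp_Mz (i : Fin d) (f : HK κ d E) (β : Fin d → ℕ) :
    toLp (Mz κ E i f) β = if β i = 0 then 0 else
      ((√ (κ.weight (β - Pi.single i 1) / κ.weight β) : ℝ) : ℂ) • toLp f (β - Pi.single i 1) := by
  have h : toLp (Mz κ E i f) β = (if β i = 0 then (0 : HK κ d E →ₗ[ℂ] E) else
      ((√ (κ.weight (β - Pi.single i 1) / κ.weight β) : ℝ) : ℂ) •
        coord (β - Pi.single i 1)) f := rfl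
  rw [h]
  split_ifs <;> rfl

lemma toLp_Delta (f : HK κ d E) (α : Fin d → ℕ) :
    toLp (Delta κ d E f) α =
      ((κ.a (∑ i, α i + 1) / κ.a (∑ i, α i) : ℝ) : ℂ) • toLp f α := rfl

lemma hasSum_inner (f g : HK κ d E) :
    HasSum (fun α : Fin d → ℕ => ⟪toLp f α, toLp g α⟫_ℂ) ⟪f, g⟫_ℂ := by
  have h := lp.hasSum_inner (𝕜 := ℂ) (toLp f) (toLp g)
  rwa [LinearIsometryEquiv.inner_map_map] at h

lemma ext_toLp {f g : HK κ d E} (h : ∀ α, toLp f α = toLp g α) : f = g :=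
  toLp.injective (lp.ext (funext h))

lemma inner_Delta_left (f g : HK κ d E) : ⟪Delta κ d E f, g⟫_ℂ = ⟪f, Delta κ d E g⟫_ℂ := by
  refine (hasSum_inner _ _).unique ((hasSum_inner _ _).congr_fun fun α => ?_)
  rw [toLp_Delta, toLp_Delta, inner_smul_left, inner_smul_right, Complex.conj_ofReal]

variable (d) in
/-- The origin as a point of the ball. -/
def origin : Ball d := ⟨0, by simp⟩

variable (κ d E) in
/-- The embedding of `E` into `H_K(E)` as the constant functions, which are the kernel functions
`K(·, 0) v`. -/
def const : E →L[ℂ] HK κ d E := kerL κ E (origin d)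

lemma toLp_const (v : E) (α : Fin d → ℕ) : toLp (const κ d E v) α = if α = 0 then v else 0 := by
  rw [const, toLp_kerL]
  split_ifs with h
  · simp [h, κ.weight_zero]
  · obtain ⟨i, hi⟩ : ∃ i, α i ≠ 0 := Function.ne_iff.1 h
    have : ∏ j, (origin d).1 j ^ α j = 0 :=
      Finset.prod_eq_zero (Finset.mem_univ i) (by simp [origin, hi])
    rw [this, star_zero, mul_zero, zero_smul]

lemma coeff_zero (f : HK κ d E) : coeff f 0 = toLp f 0 := by
  simp [coeff, κ.weight_zero]

lemma inner_const_left (v : E) (f : HK κ d E) : ⟪const κ d E v, f⟫_ℂ = ⟪v, coeff f 0⟫_ℂ := by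
  rw [← (hasSum_inner _ _).tsum_eq, tsum_eq_single 0]
  · rw [toLp_const, if_pos rfl, coeff_zero]
  · intro α hα
    rw [toLp_const, if_neg hα, inner_zero_left]

lemma coeff_zero_Mz (i : Fin d) (f : HK κ d E) : coeff (Mz κ E i f) 0 = 0 := by
  rw [coeff_Mz, if_pos (Pi.zero_apply i)]

variable [CompleteSpace E]

lemma commute_Mz (i j : Fin d) : Commute (Mz κ E i) (Mz κ E j) := by
  refine ContinuousLinearMap.ext fun f => RKHS.coeCLM_injective (funext fun z => ?_)
  change (Mz κ E i (Mz κ E j f)) z = (Mz κ E j (Mz κ E i f)) z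
  simp only [Mz_apply, smul_smul, mul_comm]

/-- In coordinates, `M_{z_i}^*` is the weighted backward shift. -/
lemma toLp_adjoint_Mz (i : Fin d) (f : HK κ d E) (β : Fin d → ℕ) :
    toLp (adjoint (Mz κ E i) f) β =
      ((√ (κ.weight β / κ.weight (β + Pi.single i 1)) : ℝ) : ℂ) •
        toLp f (β + Pi.single i 1) := by
  classical
  refine ext_inner_left ℂ fun v => ?_
  let g : HK κ d E := toLp.symm (lp.single 2 β v)
  have hg : ∀ α, toLp g α = lp.single (E := fun _ : Fin d → ℕ => E) 2 β v α := fun α => rfl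
  have h1 : ⟪g, adjoint (Mz κ E i) f⟫_ℂ = ⟪v, toLp (adjoint (Mz κ E i) f) β⟫_ℂ := by
    rw [← LinearIsometryEquiv.inner_map_map toLp]
    exact lp.inner_single_left (G := fun _ : Fin d → ℕ => E) β v _
  rw [← h1, adjoint_inner_right, ← (hasSum_inner _ _).tsum_eq,
    tsum_eq_single (β + Pi.single i 1)]
  · rw [toLp_Mz, if_neg (by simp), add_tsub_cancel_right, inner_smul_left, inner_smul_right,
      Complex.conj_ofReal, hg, lp.single_apply_self]
  · intro α hα
    rw [toLp_Mz]
    split_ifs with h0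
    · simp
    · rw [hg, lp.single_apply_ne, smul_zero, inner_zero_left]
      rintro h
      exact hα (by rw [← h, sub_single_add h0])

lemma const_apply (v : E) (z : Ball d) : const κ d E v z = v := by
  have h := hasSum_apply (const κ d E v) z
  rw [← h.tsum_eq, tsum_eq_single 0]
  · rw [coeff_zero, toLp_const]; simp
  · intro α hα
    rw [coeff, toLp_const, if_neg hα, smul_zero, smul_zero]

lemma adjoint_Mz_const (i : Fin d) (v : E) : adjoint (Mz κ E i) (const κ d E v) = 0 := by
  refine ext_inner_right ℂ fun f => ?_
  rw [adjoint_inner_left, inner_const_left, coeff_zero_Mz, inner_zero_right, inner_zero_left]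

/-- `M_z (⊕ Δ) M_z^*` is the projection onto the functions that vanish at `0`: the weights of
`M_z M_z^*` are `a_{n-1} / a_n` on the homogeneous functions of degree `n ≥ 1`, and `⊕ Δ` cancels
them. -/
lemma sum_Mz_Delta_adjoint_Mz (f : HK κ d E) :
    ∑ i, Mz κ E i (Delta κ d E (adjoint (Mz κ E i) f)) = f - const κ d E (coeff f 0) := by
  refine ext_toLp fun β => ?_
  have hterm : ∀ i, toLp (Mz κ E i (Delta κ d E (adjoint (Mz κ E i) f))) β
      = (((β i : ℝ) / (∑ j, β j : ℕ) : ℝ) : ℂ) • toLp f β := by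
    intro i
    rw [toLp_Mz]
    split_ifs with h0
    · simp [h0]
    · obtain ⟨α, rfl⟩ : ∃ α : Fin d → ℕ, β = α + Pi.single i 1 := ⟨_, (sub_single_add h0).symm⟩
      have hw : ((α i : ℝ) + 1) * (Nat.multinomial Finset.univ (α + Pi.single i 1) : ℝ)
          = ((∑ j, α j : ℕ) + 1) * Nat.multinomial Finset.univ α := by
        exact_mod_cast succ_mul_multinomial_add_single α i
      rw [toLp_Delta, toLp_adjoint_Mz, add_tsub_cancel_right, smul_smul, smul_smul]
      simp only [← Complex.ofReal_mul]
      congr 2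
      rw [mul_right_comm, Real.mul_self_sqrt (div_pos (κ.weight_pos _) (κ.weight_pos _)).le,
        KernelSeries.weight, KernelSeries.weight, sum_add_single]
      have h1 := (κ.a_pos (∑ j, α j)).ne'
      have h2 := (κ.a_pos (∑ j, α j + 1)).ne'
      have h3 : (Nat.multinomial Finset.univ (α + Pi.single i 1) : ℝ) ≠ 0 := by
        exact_mod_cast (Nat.multinomial_pos _ _).ne'
      have h4 : ((∑ j, α j : ℕ) : ℝ) + 1 ≠ 0 := by positivity
      simp only [Pi.add_apply, Pi.single_eq_same]
      push_cast at hw h4 ⊢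
      field_simp
      linarith
  have hsum : toLp (∑ i, Mz κ E i (Delta κ d E (adjoint (Mz κ E i) f))) β
      = ∑ i, toLp (Mz κ E i (Delta κ d E (adjoint (Mz κ E i) f))) β := by
    rw [← coord_apply, map_sum]; rfl
  have hsub : toLp (f - const κ d E (coeff f 0)) β
      = toLp f β - toLp (const κ d E (coeff f 0)) β := by
    rw [← coord_apply, map_sub]; rfl
  rw [hsum, hsub, Finset.sum_congr rfl fun i _ => hterm i, ← Finset.sum_smul, toLp_const]
  split_ifs with h
  · subst h
    simp [coeff_zero]
  · obtain ⟨i, hi⟩ : ∃ i, β i ≠ 0 := Function.ne_iff.1 h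
    have hne : ((∑ j, β j : ℕ) : ℝ) ≠ 0 := by
      have : 0 < ∑ j, β j := Finset.sum_pos' (fun _ _ => Nat.zero_le _)
        ⟨i, Finset.mem_univ i, Nat.pos_of_ne_zero hi⟩
      exact_mod_cast this.ne'
    rw [← Complex.ofReal_sum, ← Finset.sum_div, ← Nat.cast_sum, div_self hne]
    simp

end HK

/-! ### The dilation -/

namespace IsPureKContraction

variable {κ : KernelSeries} {d : ℕ} {H : Type*} [NormedAddCommGroup H] [InnerProductSpace ℂ H]
  [CompleteSpace H] {T : Fin d → H →L[ℂ] H}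
variable {E : Type*} [NormedAddCommGroup E] [InnerProductSpace ℂ E] [CompleteSpace E]
variable {G : Type*} [NormedAddCommGroup G] [InnerProductSpace ℂ G] [CompleteSpace G]

lemma toLp_dilation (hT : IsPureKContraction κ T) (C : H →L[ℂ] E)
    (hC : adjoint C ∘L C = hT.defect) (h : H) (α : Fin d → ℕ) :
    HK.toLp (hT.dilation C hC h) α =
      ((√ (κ.weight α) : ℝ) : ℂ) • C (adjoint (tuplePow T α) h) := rfl

/-- The dilation intertwines `T_i^*` and `M_{z_i}^*`. -/
lemma adjoint_Mz_dilation (hT : IsPureKContraction κ T) (C : H →L[ℂ] E)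
    (hC : adjoint C ∘L C = hT.defect) (i : Fin d) (h : H) :
    adjoint (HK.Mz κ E i) (hT.dilation C hC h) = hT.dilation C hC (adjoint (T i) h) := by
  refine HK.ext_toLp fun β => ?_
  rw [HK.toLp_adjoint_Mz, toLp_dilation, toLp_dilation, adjoint_tuplePow_add_single T hT.comm,
    smul_smul, ← Complex.ofReal_mul,
    ← Real.sqrt_mul (div_pos (κ.weight_pos _) (κ.weight_pos _)).le,
    div_mul_cancel₀ _ (κ.weight_pos _).ne']

/-- `j_C^* Δ j_C` depends on `C^* C` only. -/
lemma inner_Delta_dilation_eq (hT : IsPureKContraction κ T) (C : H →L[ℂ] E)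
    (hC : adjoint C ∘L C = hT.defect) (C' : H →L[ℂ] G) (hC' : adjoint C' ∘L C' = hT.defect)
    (g h : H) :
    ⟪hT.dilation C hC g, HK.Delta κ d E (hT.dilation C hC h)⟫_ℂ
      = ⟪hT.dilation C' hC' g, HK.Delta κ d G (hT.dilation C' hC' h)⟫_ℂ := by
  refine (HK.hasSum_inner _ _).unique ((HK.hasSum_inner _ _).congr_fun fun α => ?_)
  have key : ∀ u v : H, ⟪C u, C v⟫_ℂ = ⟪C' u, C' v⟫_ℂ := fun u v => by
    rw [← adjoint_inner_right, ← adjoint_inner_right C', ← ContinuousLinearMap.comp_apply, hC,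
      ← ContinuousLinearMap.comp_apply, hC']
  simp only [HK.toLp_Delta, toLp_dilation, inner_smul_left, inner_smul_right, key]

lemma inner_DeltaT (hT : IsPureKContraction κ T) (C : H →L[ℂ] E)
    (hC : adjoint C ∘L C = hT.defect) (g h : H) :
    ⟪hT.dilation C hC g, HK.Delta κ d E (hT.dilation C hC h)⟫_ℂ = ⟪g, hT.DeltaT h⟫_ℂ := by
  rw [hT.inner_Delta_dilation_eq C hC hT.defectOp hT.adjoint_defectOp_comp]
  exact (adjoint_inner_right hT.canonicalDilation _ _).symm

end IsPureKContraction

/-! ### Growth of the coefficients -/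

namespace KernelSeries

variable (κ : KernelSeries)

/-- The limit of `aₙ / aₙ₊₁` is the radius of convergence of `k`, so it is at least `1`. -/
lemma one_le_of_tendsto_ratio {r : ℝ}
    (hr : Tendsto (fun n => κ.a n / κ.a (n + 1)) atTop (𝓝 r)) : 1 ≤ r := by
  by_contra! hr1
  have hr0 : 0 ≤ r := ge_of_tendsto' hr fun n => (div_pos (κ.a_pos _) (κ.a_pos _)).le
  obtain ⟨x, hx, hx1⟩ := exists_between hr1
  have hx0 : 0 < x := hr0.trans_lt hx
  have hs := κ.summable_real hx0.le hx1
  have hlim : ∀ᶠ n in atTop, κ.a n / κ.a (n + 1) < x := hr.eventually_lt_const hx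
  obtain ⟨N, hN⟩ := eventually_atTop.1 hlim
  -- the terms `aₙ xⁿ` increase from `N` on, so they do not tend to `0`
  have hmono : ∀ n ≥ N, κ.a N * x ^ N ≤ κ.a n * x ^ n := by
    intro n hn
    induction n, hn using Nat.le_induction with
    | base => exact le_rfl
    | succ n hn ih =>
      refine ih.trans ?_
      have := (div_lt_iff₀ (κ.a_pos _)).1 (hN n hn)
      rw [pow_succ']
      have hp := pow_pos hx0 n
      nlinarith
  have h0 := ge_of_tendsto hs.tendsto_atTop_zero (eventually_atTop.2 ⟨N, hmono⟩)
  exact (mul_pos (κ.a_pos N) (pow_pos hx0 N)).not_ge h0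

/-- `aₘ ≤ A ρⁿ aₘ₊ₙ` with `A` independent of `m` and `n`, for every `ρ` above the limit of
`aₙ / aₙ₊₁`. -/
lemma exists_a_le_mul_pow_mul {r ρ : ℝ}
    (hr : Tendsto (fun n => κ.a n / κ.a (n + 1)) atTop (𝓝 r)) (hρ : r < ρ) (hρ0 : 0 < ρ) :
    ∃ A : ℝ, 0 < A ∧ ∀ m n, κ.a m ≤ A * ρ ^ n * κ.a (m + n) := by
  obtain ⟨N, hN⟩ := eventually_atTop.1 (hr.eventually_lt_const hρ)
  set b : ℕ → ℝ := fun m => κ.a m * ρ ^ m with hb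
  have hb0 : ∀ m, 0 < b m := fun m => mul_pos (κ.a_pos m) (pow_pos hρ0 m)
  have hmono : ∀ m ≥ N, ∀ l ≥ m, b m ≤ b l := by
    intro m hm l hl
    induction l, hl using Nat.le_induction with
    | base => exact le_rfl
    | succ l hl ih =>
      refine ih.trans ?_
      have := (div_lt_iff₀ (κ.a_pos _)).1 (hN l (hm.trans hl))
      simp only [hb, pow_succ']
      have hp := pow_pos hρ0 l
      nlinarith
  -- `aₘ ρᵐ` increases from `N` on; `S * R` bounds all quotients `bᵢ / bₗ` of the initial terms
  set S := ∑ i ∈ Finset.range (N + 1), b i with hS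
  set R := ∑ i ∈ Finset.range (N + 1), (b i)⁻¹ with hR
  have hS0 : ∀ i ≤ N, b i ≤ S := fun i hi =>
    Finset.single_le_sum (f := b) (fun i _ => (hb0 i).le) (Finset.mem_range.2 (by omega))
  have hR0 : ∀ i ≤ N, (b i)⁻¹ ≤ R := fun i hi =>
    Finset.single_le_sum (f := fun i => (b i)⁻¹) (fun i _ => (inv_pos.2 (hb0 i)).le)
      (Finset.mem_range.2 (by omega))
  have hSR : ∀ i ≤ N, ∀ l ≤ N, b i ≤ S * R * b l := fun i hi l hl => by
    calc b i ≤ S := hS0 i hi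
      _ = S * ((b l)⁻¹ * b l) := by rw [inv_mul_cancel₀ (hb0 l).ne', mul_one]
      _ ≤ S * (R * b l) := by
        have := (hb0 i).le.trans (hS0 i hi)
        have := (hb0 l).le
        gcongr
        exact hR0 l hl
      _ = S * R * b l := by ring
  have h1 : 1 ≤ S * R := by
    have := hSR N le_rfl N le_rfl
    have := hb0 N
    nlinarith
  have key : ∀ m l, m ≤ l → b m ≤ S * R * b l := by
    intro m l hml
    rcases le_total N m with hm | hm
    · have := hmono m hm l hml
      have := hb0 l
      nlinarith
    · rcases le_total N l with hl | hl
      · refine (hSR m hm N le_rfl).trans ?_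
        gcongr
        exact hmono N le_rfl l hl
      · exact hSR m hm l hl
  refine ⟨S * R, by linarith, fun m n => ?_⟩
  have h := key m (m + n) (Nat.le_add_right _ _)
  simp only [hb, pow_add] at h
  have hp := pow_pos hρ0 m
  refine le_of_mul_le_mul_right (h.trans_eq ?_) hp
  ring

end KernelSeries

/-! ### Iterates of `σ_T` -/

section Sigma

variable {d : ℕ} {H : Type*} [NormedAddCommGroup H] [InnerProductSpace ℂ H] [CompleteSpace H]

lemma inner_sigma (T : Fin d → H →L[ℂ] H) (X : H →L[ℂ] H) (h : H) :
    ⟪sigma T X h, h⟫_ℂ = ∑ i, ⟪X (adjoint (T i) h), adjoint (T i) h⟫_ℂ := by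
  rw [sigma, sum_apply, sum_inner]
  refine Finset.sum_congr rfl fun i _ => ?_
  rw [adjoint_inner_right]
  rfl

lemma sigma_iterate_sum_smul (T : Fin d → H →L[ℂ] H) (s : Finset ℕ) (c : ℕ → ℂ)
    (X : ℕ → H →L[ℂ] H) (n : ℕ) :
    (sigma T)^[n] (∑ m ∈ s, c m • X m) = ∑ m ∈ s, c m • (sigma T)^[n] (X m) := by
  induction n generalizing X with
  | zero => rfl
  | succ n ih =>
    simp only [Function.iterate_succ_apply]
    rw [← ih]
    congr 1
    ext h
    simp only [sigma, sum_apply, smul_apply, ContinuousLinearMap.comp_apply, map_sum, map_smul,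
      Finset.smul_sum]
    rw [Finset.sum_comm]

lemma re_inner_sigma_iterate_nonneg (T : Fin d → H →L[ℂ] H) {X : H →L[ℂ] H}
    (hX : ∀ h, 0 ≤ RCLike.re ⟪X h, h⟫_ℂ) (n : ℕ) (h : H) :
    0 ≤ RCLike.re ⟪(sigma T)^[n] X h, h⟫_ℂ := by
  induction n generalizing h with
  | zero => exact hX h
  | succ n ih =>
    rw [Function.iterate_succ_apply', inner_sigma, map_sum]
    exact Finset.sum_nonneg fun i _ => ih _

/-- The iterates of `σ_T` are continuous for strong convergence of sequences. -/
lemma tendsto_sigma_iterate (T : Fin d → H →L[ℂ] H) {S : ℕ → H →L[ℂ] H} {X : H →L[ℂ] H}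
    (hS : ∀ h, Tendsto (fun N => S N h) atTop (𝓝 (X h))) (n : ℕ) (h : H) :
    Tendsto (fun N => (sigma T)^[n] (S N) h) atTop (𝓝 ((sigma T)^[n] X h)) := by
  induction n generalizing h with
  | zero => exact hS h
  | succ n ih =>
    simp only [Function.iterate_succ_apply', sigma, sum_apply, ContinuousLinearMap.comp_apply]
    exact tendsto_finsetSum _ fun i _ => ((T i).continuous.tendsto _).comp (ih _)

/-- For a pure `K`-contraction `1 = SOT-∑ aₘ σ_T^m(1/K(T))`, hence
`σ_T^n(1) = SOT-∑ aₘ σ_T^{m+n}(1/K(T)) ≤ sup_m (aₘ / aₘ₊ₙ)`. -/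
lemma IsPureKContraction.re_inner_sigma_iterate_one_le {κ : KernelSeries}
    {T : Fin d → H →L[ℂ] H} (hT : IsPureKContraction κ T) {n : ℕ} {A : ℝ}
    (hA : ∀ m, κ.a m ≤ A * κ.a (m + n)) (h : H) :
    RCLike.re ⟪(sigma T)^[n] 1 h, h⟫_ℂ ≤ A * ‖h‖ ^ 2 := by
  set P := hT.defect with hP
  set S : ℕ → H →L[ℂ] H := fun N => ∑ m ∈ Finset.range (N + 1), (κ.a m : ℂ) • (sigma T)^[m] P
  set q : ℕ → ℝ := fun m => RCLike.re ⟪(sigma T)^[m] P h, h⟫_ℂ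
  have hq0 : ∀ m, 0 ≤ q m := fun m => re_inner_sigma_iterate_nonneg T
    (fun h => hT.defect_isPositive.re_inner_nonneg_left h) m h
  have hA0 : 0 ≤ A := by
    have h1 := hA 0
    have h2 := κ.a_pos 0
    have h3 := κ.a_pos (0 + n)
    by_contra! hneg
    nlinarith
  have hS : ∀ h, Tendsto (fun N => S N h) atTop (𝓝 ((1 : H →L[ℂ] H) h)) := fun h => by
    have := (hT.pure h).const_sub h
    simpa [S, hP] using this
  have hre : Continuous fun v : H => RCLike.re ⟪v, h⟫_ℂ := by fun_prop
  have hSn := fun n => (hre.tendsto _).comp (tendsto_sigma_iterate T hS n h)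
  have hval : ∀ n N, RCLike.re ⟪(sigma T)^[n] (S N) h, h⟫_ℂ
      = ∑ m ∈ Finset.range (N + 1), κ.a m * q (m + n) := by
    intro n N
    simp only [S]
    rw [sigma_iterate_sum_smul, sum_apply, sum_inner, map_sum]
    refine Finset.sum_congr rfl fun m _ => ?_
    rw [← Function.iterate_add_apply, add_comm n m, smul_apply, inner_smul_left,
      Complex.conj_ofReal]
    exact Complex.re_ofReal_mul _ _
  have hle : ∀ N, ∑ m ∈ Finset.range (N + 1), κ.a m * q m ≤ ‖h‖ ^ 2 := by
    have hmono : Monotone fun N => ∑ m ∈ Finset.range (N + 1), κ.a m * q m :=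
      monotone_nat_of_le_succ fun N => by
        rw [Finset.sum_range_succ _ (N + 1)]
        exact le_add_of_nonneg_right (mul_nonneg (κ.a_pos _).le (hq0 _))
    intro N
    refine hmono.ge_of_tendsto (b := N) ?_
    have h1 := hSn 0
    simp only [Function.comp_def, hval, add_zero] at h1
    have h2 : RCLike.re ⟪(sigma T)^[0] (1 : H →L[ℂ] H) h, h⟫_ℂ = ‖h‖ ^ 2 :=
      inner_self_eq_norm_sq h
    rwa [h2] at h1
  refine le_of_tendsto' (hSn n) fun N => ?_
  rw [Function.comp_apply, hval]
  calc ∑ m ∈ Finset.range (N + 1), κ.a m * q (m + n)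
      ≤ ∑ m ∈ Finset.range (N + 1), A * (κ.a (n + m) * q (n + m)) := by
        refine Finset.sum_le_sum fun m _ => ?_
        rw [← mul_assoc, add_comm n m]
        exact mul_le_mul_of_nonneg_right (hA m) (hq0 _)
    _ ≤ A * ∑ m ∈ Finset.range (n + (N + 1)), κ.a m * q m := by
        rw [← Finset.mul_sum, Finset.sum_range_add _ n (N + 1)]
        refine mul_le_mul_of_nonneg_left (le_add_of_nonneg_left ?_) hA0
        exact Finset.sum_nonneg fun m _ => mul_nonneg (κ.a_pos m).le (hq0 m)
    _ ≤ A * ‖h‖ ^ 2 := mul_le_mul_of_nonneg_left (hle (n + N)) hA0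

end Sigma

/-! ### The power series of `z ↦ F(Z T^*)` -/

section Pencil

variable {d : ℕ} {H : Type*} [NormedAddCommGroup H] [InnerProductSpace ℂ H]

/-- The row operators `Z : H^d → H`, `(h_i) ↦ ∑ z_i h_i`, as a linear function of `z`. -/
def rowZ (d : ℕ) (H : Type*) [NormedAddCommGroup H] [InnerProductSpace ℂ H] :
    EuclideanSpace ℂ (Fin d) →L[ℂ] (PiLp 2 (fun _ : Fin d => H) →L[ℂ] H) :=
  ∑ i, (EuclideanSpace.proj i : EuclideanSpace ℂ (Fin d) →L[ℂ] ℂ).smulRight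
    (PiLp.proj 2 (fun _ : Fin d => H) i)

lemma rowZ_apply (z : EuclideanSpace ℂ (Fin d)) :
    rowZ d H z = row fun i => z i • ContinuousLinearMap.id ℂ H := by
  ext h
  simp [rowZ, sum_apply]

variable [CompleteSpace H]

/-- The operators `Z T^* = ∑ z_i T_i^*` as a linear function of `z`. -/
def pencil (T : Fin d → H →L[ℂ] H) : EuclideanSpace ℂ (Fin d) →L[ℂ] (H →L[ℂ] H) :=
  ∑ i, (EuclideanSpace.proj i : EuclideanSpace ℂ (Fin d) →L[ℂ] ℂ).smulRight (adjoint (T i))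

lemma pencil_apply (T : Fin d → H →L[ℂ] H) (z : EuclideanSpace ℂ (Fin d)) :
    pencil T z = ∑ i, z i • adjoint (T i) := by
  simp [pencil, sum_apply]

lemma row_comp_adjoint_row (T : Fin d → H →L[ℂ] H) (z : EuclideanSpace ℂ (Fin d)) :
    row (fun i => z i • ContinuousLinearMap.id ℂ H) ∘L adjoint (row T) = pencil T z := by
  ext h
  simp [pencil_apply, adjoint_row_apply, sum_apply]

/-- The Cauchy-Schwarz inequality, applied factor by factor, bounds a product of operators
`Z_k T^*` by `σ_T^n(1)`. This is better than the product of the norms of the factors. -/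
lemma norm_prod_pencil_sq_le (T : Fin d → H →L[ℂ] H) (n : ℕ)
    (m : Fin n → EuclideanSpace ℂ (Fin d)) (h : H) :
    ‖(List.ofFn fun k => pencil T (m k)).prod h‖ ^ 2
      ≤ (∏ k, ‖m k‖) ^ 2 * RCLike.re ⟪(sigma T)^[n] 1 h, h⟫_ℂ := by
  induction n generalizing h with
  | zero =>
    have h2 : RCLike.re ⟪(sigma T)^[0] (1 : H →L[ℂ] H) h, h⟫_ℂ = ‖h‖ ^ 2 :=
      inner_self_eq_norm_sq h
    rw [h2]
    simp
  | succ n ih =>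
    set Q := (List.ofFn fun k : Fin n => pencil T (m k.castSucc)).prod with hQ
    have hprod : (List.ofFn fun k => pencil T (m k)).prod = Q * pencil T (m (Fin.last n)) := by
      rw [List.ofFn_succ', List.prod_concat]
    set z := m (Fin.last n) with hz
    have hval : (Q * pencil T z) h = ∑ i, z i • Q (adjoint (T i) h) := by
      change Q (pencil T z h) = _
      simp [pencil_apply, sum_apply]
    rw [hprod, hval, Function.iterate_succ_apply', inner_sigma, map_sum, Fin.prod_univ_castSucc,
      mul_pow]
    calc ‖∑ i, z i • Q (adjoint (T i) h)‖ ^ 2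
        ≤ (∑ i, ‖z i‖ * ‖Q (adjoint (T i) h)‖) ^ 2 := by
          gcongr
          refine (norm_sum_le _ _).trans (le_of_eq ?_)
          simp only [norm_smul]
      _ ≤ (∑ i, ‖z i‖ ^ 2) * ∑ i, ‖Q (adjoint (T i) h)‖ ^ 2 :=
          Finset.sum_mul_sq_le_sq_mul_sq _ _ _
      _ ≤ ‖z‖ ^ 2 * ∑ i, (∏ k : Fin n, ‖m k.castSucc‖) ^ 2 *
            RCLike.re ⟪(sigma T)^[n] 1 (adjoint (T i) h), adjoint (T i) h⟫_ℂ := by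
          rw [← EuclideanSpace.norm_sq_eq]
          gcongr with i
          exact ih _ _
      _ = _ := by rw [← Finset.mul_sum]; ring

/-- The power series with the terms `aₙ₊₁ (Z T^*)ⁿ`. -/
def pencilSeries (κ : KernelSeries) (T : Fin d → H →L[ℂ] H) :
    FormalMultilinearSeries ℂ (EuclideanSpace ℂ (Fin d)) (H →L[ℂ] H) := fun n =>
  (κ.a (n + 1) : ℂ) •
    (ContinuousMultilinearMap.mkPiAlgebraFin ℂ n (H →L[ℂ] H)).compContinuousLinearMap
      fun _ => pencil T

lemma pencilSeries_apply (κ : KernelSeries) (T : Fin d → H →L[ℂ] H) (n : ℕ)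
    (m : Fin n → EuclideanSpace ℂ (Fin d)) :
    pencilSeries κ T n m = (κ.a (n + 1) : ℂ) • (List.ofFn fun k => pencil T (m k)).prod := by
  simp [pencilSeries]

lemma pencilSeries_diag (κ : KernelSeries) (T : Fin d → H →L[ℂ] H) (n : ℕ)
    (z : EuclideanSpace ℂ (Fin d)) :
    (pencilSeries κ T n fun _ => z) = (κ.a (n + 1) : ℂ) • pencil T z ^ n := by
  rw [pencilSeries_apply, List.ofFn_const, List.prod_replicate]

lemma IsPureKContraction.norm_pencilSeries_le {κ : KernelSeries} {T : Fin d → H →L[ℂ] H}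
    (hT : IsPureKContraction κ T) {n : ℕ} {A : ℝ} (hA0 : 0 ≤ A)
    (hA : ∀ m, κ.a m ≤ A ^ 2 * κ.a (m + n)) :
    ‖pencilSeries κ T n‖ ≤ κ.a (n + 1) * A := by
  have ha := (κ.a_pos (n + 1)).le
  refine ContinuousMultilinearMap.opNorm_le_bound (mul_nonneg ha hA0) fun m => ?_
  rw [pencilSeries_apply, norm_smul, Complex.norm_real, Real.norm_of_nonneg ha, mul_assoc]
  refine mul_le_mul_of_nonneg_left ?_ ha
  have hp : 0 ≤ ∏ k, ‖m k‖ := Finset.prod_nonneg fun _ _ => norm_nonneg _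
  refine ContinuousLinearMap.opNorm_le_bound _ (mul_nonneg hA0 hp) fun h => ?_
  refine le_of_sq_le_sq ?_ (by positivity)
  calc _ ≤ (∏ k, ‖m k‖) ^ 2 * RCLike.re ⟪(sigma T)^[n] 1 h, h⟫_ℂ :=
        norm_prod_pencil_sq_le T n m h
    _ ≤ (∏ k, ‖m k‖) ^ 2 * (A ^ 2 * ‖h‖ ^ 2) := by
        gcongr
        exact hT.re_inner_sigma_iterate_one_le hA h
    _ = _ := by ring

/-- The series of `F(Z T^*)` converges on the unit ball. With `r = lim aₙ / aₙ₊₁ ≥ 1`, its `n`-th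
term has the norm `O(aₙ₊₁ ρ^{n/2})` for each `ρ > r`, so that the radius of convergence is at least
`r / √r`. -/
lemma IsPureKContraction.one_le_radius {κ : KernelSeries} {T : Fin d → H →L[ℂ] H}
    (hT : IsPureKContraction κ T)
    (hr : ∃ r : ℝ, Tendsto (fun n => κ.a n / κ.a (n + 1)) atTop (𝓝 r)) :
    1 ≤ (pencilSeries κ T).radius := by
  obtain ⟨r, hr⟩ := hr
  have hr1 := κ.one_le_of_tendsto_ratio hr
  have hr0 : 0 < r := by linarith
  refine le_of_forall_lt_imp_le_of_dense fun s hs => ?_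
  lift s to NNReal using hs.ne_top
  rcases eq_or_ne s 0 with rfl | hs0
  · simp
  have hs1 : (s : ℝ) < 1 := by exact_mod_cast hs
  have hs0' : (0 : ℝ) < s := by positivity
  set ρ : ℝ := r / s with hρ
  have hρ0 : 0 < ρ := div_pos hr0 hs0'
  have hrρ : r < ρ := by rw [hρ, lt_div_iff₀ hs0']; nlinarith
  obtain ⟨A, hA0, hA⟩ := κ.exists_a_le_mul_pow_mul hr hrρ hρ0
  have hbound : ∀ n, ‖pencilSeries κ T n‖ * (s : ℝ) ^ n
      ≤ √A * (κ.a (n + 1) * (√ρ * s) ^ n) := by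
    intro n
    have h1 : ‖pencilSeries κ T n‖ ≤ κ.a (n + 1) * (√A * √ρ ^ n) := by
      refine hT.norm_pencilSeries_le (by positivity) fun m => ?_
      rw [mul_pow, Real.sq_sqrt hA0.le, ← pow_mul, mul_comm n 2, pow_mul, Real.sq_sqrt hρ0.le]
      exact hA m n
    calc _ ≤ κ.a (n + 1) * (√A * √ρ ^ n) * (s : ℝ) ^ n := by gcongr
      _ = _ := by rw [mul_pow]; ring
  -- `√ρ s = √(r s) < √r ≤ r`
  have hq : √ρ * s < r := by
    have h2 : √ρ * s = √(r * s) := by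
      rw [← Real.sqrt_sq hs0'.le, ← Real.sqrt_mul hρ0.le, hρ, Real.sqrt_sq hs0'.le]
      congr 1
      field_simp
    rw [h2, Real.sqrt_lt' hr0]
    nlinarith
  have hq0 : 0 < √ρ * s := by positivity
  have hsum : Summable fun n => κ.a (n + 1) * (√ρ * s) ^ n := by
    have hlim : Tendsto (fun n => ‖κ.a (n + 1 + 1) * (√ρ * s) ^ (n + 1)‖ /
        ‖κ.a (n + 1) * (√ρ * s) ^ n‖) atTop (𝓝 (r⁻¹ * (√ρ * s))) := by
      refine (((tendsto_add_atTop_iff_nat 1).2 hr).inv₀ hr0.ne' |>.mul_const _).congr fun n => ?_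
      rw [Real.norm_of_nonneg (mul_pos (κ.a_pos _) (pow_pos hq0 _)).le,
        Real.norm_of_nonneg (mul_pos (κ.a_pos _) (pow_pos hq0 _)).le, pow_succ]
      have h1 := (κ.a_pos (n + 1)).ne'
      have h2 := (κ.a_pos (n + 1 + 1)).ne'
      have h3 := (pow_pos hq0 n).ne'
      rw [inv_div]
      field_simp
    refine summable_of_ratio_test_tendsto_lt_one ?_ ?_ hlim
    · rw [inv_mul_lt_iff₀ hr0, mul_one]; exact hq
    · exact Eventually.of_forall fun n => (mul_pos (κ.a_pos _) (pow_pos hq0 _)).ne'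
  refine FormalMultilinearSeries.le_radius_of_summable _
    (Summable.of_nonneg_of_le (fun n => by positivity) hbound (hsum.mul_left _))

lemma IsPureKContraction.hasFPowerSeriesOnBall {κ : KernelSeries} {T : Fin d → H →L[ℂ] H}
    (hT : IsPureKContraction κ T)
    (hr : ∃ r : ℝ, Tendsto (fun n => κ.a n / κ.a (n + 1)) atTop (𝓝 r)) :
    HasFPowerSeriesOnBall (fun z => κ.F (pencil T z)) (pencilSeries κ T) 0 1 := by
  have h1 := hT.one_le_radius hr
  have h : (fun z => κ.F (pencil T z)) = (pencilSeries κ T).sum := by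
    funext z
    exact tsum_congr fun n => (pencilSeries_diag κ T n z).symm
  rw [h]
  exact ((pencilSeries κ T).hasFPowerSeriesOnBall (one_pos.trans_le h1)).mono one_pos h1

lemma IsPureKContraction.analyticOnNhd_F {κ : KernelSeries} {T : Fin d → H →L[ℂ] H}
    (hT : IsPureKContraction κ T)
    (hr : ∃ r : ℝ, Tendsto (fun n => κ.a n / κ.a (n + 1)) atTop (𝓝 r)) :
    AnalyticOnNhd ℂ (fun z => κ.F (pencil T z)) (Ball d) := by
  have h := (hT.hasFPowerSeriesOnBall hr).analyticOnNhd
  rwa [← ENNReal.coe_one, Metric.eball_coe] at h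

lemma IsPureKContraction.hasSum_F {κ : KernelSeries} {T : Fin d → H →L[ℂ] H}
    (hT : IsPureKContraction κ T)
    (hr : ∃ r : ℝ, Tendsto (fun n => κ.a n / κ.a (n + 1)) atTop (𝓝 r)) (z : Ball d) :
    HasSum (fun n => (κ.a (n + 1) : ℂ) • pencil T z.1 ^ n) (κ.F (pencil T z.1)) := by
  have hz : z.1 ∈ Metric.eball (0 : EuclideanSpace ℂ (Fin d)) 1 := by
    rw [← ENNReal.coe_one, Metric.eball_coe]; exact z.2
  have h := (hT.hasFPowerSeriesOnBall hr).hasSum hz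
  simpa only [pencilSeries_diag, zero_add] using h

/-- Analyticity of `z ↦ D + C F(Z T^*) Z B`. -/
lemma IsPureKContraction.analyticOnNhd_realization {κ : KernelSeries} {T : Fin d → H →L[ℂ] H}
    {E Estar : Type*} [NormedAddCommGroup E] [InnerProductSpace ℂ E]
    [NormedAddCommGroup Estar] [InnerProductSpace ℂ Estar] (hT : IsPureKContraction κ T)
    (B : Estar →L[ℂ] PiLp 2 (fun _ : Fin d => H)) (C : H →L[ℂ] E) (D : Estar →L[ℂ] E)
    (hr : ∃ r : ℝ, Tendsto (fun n => κ.a n / κ.a (n + 1)) atTop (𝓝 r)) :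
    AnalyticOnNhd ℂ (fun z => D + C ∘L κ.F (pencil T z) ∘L rowZ d H z ∘L B) (Ball d) := by
  have hB : AnalyticOnNhd ℂ (fun z => rowZ d H z ∘L B) (Ball d) := fun z _ =>
    (((compL ℂ Estar (PiLp 2 fun _ : Fin d => H) H).flip B) ∘L rowZ d H).analyticAt z
  have hFB : AnalyticOnNhd ℂ (fun z => κ.F (pencil T z) ∘L rowZ d H z ∘L B) (Ball d) :=
    fun z hz => ((compL ℂ Estar H H).analyticAt_bilinear _).comp₂ (hT.analyticOnNhd_F hr z hz)
      (hB z hz)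
  exact analyticOnNhd_const.add ((compL ℂ Estar H E C).comp_analyticOnNhd hFB)

end Pencil

/-! ### The functions `W x` in `H_K(E)` -/

variable {κ : KernelSeries} {d : ℕ} {H : Type*} [NormedAddCommGroup H] [InnerProductSpace ℂ H]
  [CompleteSpace H] {T : Fin d → H →L[ℂ] H}
variable {E : Type*} [NormedAddCommGroup E] [InnerProductSpace ℂ E] [CompleteSpace E]
variable {Estar : Type*} [NormedAddCommGroup Estar] [InnerProductSpace ℂ Estar]

/-- `(Z T^*)ⁿ = ∑_{|α| = n} γ_α z^α T^{*α}`. -/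
lemma pencil_pow (hT : ∀ i j, Commute (T i) (T j)) (z : EuclideanSpace ℂ (Fin d)) (n : ℕ) :
    pencil T z ^ n = ∑ α ∈ Finset.piAntidiag Finset.univ n,
      (Nat.multinomial Finset.univ α : ℂ) • (∏ i, z i ^ α i) • adjoint (tuplePow T α) := by
  have hc : ∀ i j, Commute (z i • adjoint (T i)) (z j • adjoint (T j)) := fun i j =>
    ((commute_adjoint hT i j).smul_left _).smul_right _
  rw [pencil_apply, Finset.sum_pow_eq_sum_piAntidiag_of_commute _ _ fun i _ j _ _ => hc i j]
  refine Finset.sum_congr rfl fun α _ => ?_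
  have h : tuplePow (fun i => z i • adjoint (T i)) α = _ := tuplePow_eq_noncommProd _ hc α
  rw [← nsmul_eq_mul, ← Nat.cast_smul_eq_nsmul ℂ, adjoint_tuplePow T hT,
    ← tuplePow_smul _ (commute_adjoint hT), h]

namespace IsPureKContraction

/-- `(Δ j_C h)(z) = C F(Z T^*) h`. -/
lemma Delta_dilation_apply (hT : IsPureKContraction κ T)
    (hr : ∃ r : ℝ, Tendsto (fun n => κ.a n / κ.a (n + 1)) atTop (𝓝 r))
    (C : H →L[ℂ] E) (hC : adjoint C ∘L C = hT.defect) (h : H) (z : Ball d) :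
    HK.Delta κ d E (hT.dilation C hC h) z = C (κ.F (pencil T z.1) h) := by
  have h1 := hasSum_levels (HK.hasSum_apply (HK.Delta κ d E (hT.dilation C hC h)) z)
  have h2 := (hT.hasSum_F hr z).mapL ((C ∘L ContinuousLinearMap.apply ℂ H h))
  refine h1.unique (h2.congr_fun fun n => ?_)
  simp only [ContinuousLinearMap.comp_apply, ContinuousLinearMap.apply_apply, map_smul]
  rw [pencil_pow hT.comm, sum_apply, map_sum, Finset.smul_sum]
  refine Finset.sum_congr rfl fun α hα => ?_
  rw [Finset.mem_piAntidiag] at hα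
  simp only [HK.coeff_Delta, coeff_dilation, smul_apply, map_smul, smul_smul]
  congr 1
  rw [KernelSeries.weight, hα.1]
  have h3 : (κ.a n : ℂ) ≠ 0 := by exact_mod_cast (κ.a_pos n).ne'
  push_cast
  field_simp

/-- The operator `x ↦ W x`, that is `x ↦ D x + M_z (⊕ Δ j_C) B x`. -/
def transfer (hT : IsPureKContraction κ T) (B : Estar →L[ℂ] PiLp 2 (fun _ : Fin d => H))
    (C : H →L[ℂ] E) (D : Estar →L[ℂ] E) (hC : adjoint C ∘L C = hT.defect) :
    Estar →L[ℂ] HK κ d E :=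
  HK.const κ d E ∘L D + row (HK.Mz κ E) ∘L oplus d (HK.Delta κ d E ∘L hT.dilation C hC) ∘L B

variable (hT : IsPureKContraction κ T) (B : Estar →L[ℂ] PiLp 2 (fun _ : Fin d => H))
  (C : H →L[ℂ] E) (D : Estar →L[ℂ] E) (K1 : adjoint C ∘L C = hT.defect)

lemma transfer_eq (x : Estar) :
    hT.transfer B C D K1 x = HK.const κ d E (D x)
      + ∑ i, HK.Mz κ E i (HK.Delta κ d E (hT.dilation C K1 (B x i))) := by
  simp [transfer]

lemma transfer_apply (hr : ∃ r : ℝ, Tendsto (fun n => κ.a n / κ.a (n + 1)) atTop (𝓝 r))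
    (x : Estar) (z : Ball d) :
    hT.transfer B C D K1 x z
      = D x + C (κ.F (pencil T z.1) (rowZ d H z.1 (B x))) := by
  have hadd : hT.transfer B C D K1 x z = HK.const κ d E (D x) z
      + ∑ i, (HK.Mz κ E i (HK.Delta κ d E (hT.dilation C K1 (B x i)))) z := by
    rw [transfer_eq]
    change HK.evalL z (_ + _) = HK.evalL z _ + ∑ i, HK.evalL z _
    rw [map_add, map_sum]
  rw [hadd, HK.const_apply, rowZ_apply, row_apply, map_sum, map_sum]
  simp [HK.Mz_apply, hT.Delta_dilation_apply hr]

lemma coeff_zero_transfer (x : Estar) : HK.coeff (hT.transfer B C D K1 x) 0 = D x := by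
  refine ext_inner_left ℂ fun v => ?_
  rw [← HK.inner_const_left, transfer_eq, inner_add_right, inner_sum, Finset.sum_eq_zero,
    add_zero, HK.inner_const_left, HK.coeff_zero, HK.toLp_const, if_pos rfl]
  intro i _
  rw [HK.inner_const_left, HK.coeff_zero_Mz, inner_zero_right]

/-- Under (K4), `W x` differs by a constant from a function `f` with `M_z^* f = (⊕ j_C) B x`. -/
lemma adjoint_Mz_transfer
    (K4 : Set.range (oplus d (hT.dilation C K1) ∘L B)
      ⊆ Set.range (adjoint (row (HK.Mz κ (d := d) E)))) (x : Estar) (i : Fin d) :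
    adjoint (HK.Mz κ E i) (hT.transfer B C D K1 x) = hT.dilation C K1 (B x i) := by
  obtain ⟨f, hf⟩ := K4 ⟨x, rfl⟩
  have hfi : ∀ i, adjoint (HK.Mz κ E i) f = hT.dilation C K1 (B x i) := fun i => by
    rw [← adjoint_row_apply, hf]
    rfl
  rw [transfer_eq]
  simp only [← hfi]
  rw [HK.sum_Mz_Delta_adjoint_Mz, map_add, map_sub, HK.adjoint_Mz_const, HK.adjoint_Mz_const,
    zero_add, sub_zero]

variable [CompleteSpace Estar]

/-- (K2) says that `W E_*` is orthogonal to the range of `j_C`. -/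
lemma inner_dilation_transfer
    (K2 : adjoint D ∘L C + adjoint B ∘L oplus d hT.DeltaT ∘L adjoint (row T) = 0)
    (h : H) (x : Estar) : ⟪hT.transfer B C D K1 x, hT.dilation C K1 h⟫_ℂ = 0 := by
  have h0 := congrArg (fun X : H →L[ℂ] Estar => ⟪x, X h⟫_ℂ) K2
  simp only [add_apply, ContinuousLinearMap.comp_apply, zero_apply, inner_zero_right,
    inner_add_right, adjoint_inner_right] at h0
  rw [← h0, transfer_eq, inner_add_left, sum_inner, HK.inner_const_left, hT.coeff_dilation,
    PiLp.inner_apply]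
  congr 1
  · simp [κ.weight_zero, ← star_eq_adjoint]
  · refine Finset.sum_congr rfl fun i _ => ?_
    rw [← adjoint_inner_right, hT.adjoint_Mz_dilation, HK.inner_Delta_left, hT.inner_DeltaT,
      oplus_apply, adjoint_row_apply]

/-- (K3) and (K4) make `x ↦ W x` isometric. -/
lemma inner_transfer_self
    (K3 : adjoint D ∘L D + adjoint B ∘L oplus d hT.DeltaT ∘L B = ContinuousLinearMap.id ℂ Estar)
    (K4 : Set.range (oplus d (hT.dilation C K1) ∘L B)
      ⊆ Set.range (adjoint (row (HK.Mz κ (d := d) E)))) (x : Estar) :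
    ⟪hT.transfer B C D K1 x, hT.transfer B C D K1 x⟫_ℂ = ⟪x, x⟫_ℂ := by
  have h0 := congrArg (fun X : Estar →L[ℂ] Estar => ⟪x, X x⟫_ℂ) K3
  simp only [add_apply, ContinuousLinearMap.comp_apply, ContinuousLinearMap.id_apply,
    inner_add_right, adjoint_inner_right] at h0
  nth_rw 2 [transfer_eq]
  rw [← h0, inner_add_right, inner_sum, ← inner_conj_symm, HK.inner_const_left,
    coeff_zero_transfer, inner_conj_symm, PiLp.inner_apply]
  congr 1
  refine Finset.sum_congr rfl fun i _ => ?_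
  rw [← adjoint_inner_left, hT.adjoint_Mz_transfer B C D K1 K4, hT.inner_DeltaT, oplus_apply]

/-- The range of `j_C` is invariant under `M_z^*`, so (K2) extends to all `M_z^α (W E_*)`. -/
lemma inner_dilation_tuplePow_transfer
    (K2 : adjoint D ∘L C + adjoint B ∘L oplus d hT.DeltaT ∘L adjoint (row T) = 0)
    (α : Fin d → ℕ) (h : H) (y : Estar) :
    ⟪hT.dilation C K1 h, tuplePow (HK.Mz κ E) α (hT.transfer B C D K1 y)⟫_ℂ = 0 := by
  induction α using multiIndex_induction generalizing h with
  | zero =>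
    rw [tuplePow_zero, ← inner_conj_symm]
    change star ⟪hT.transfer B C D K1 y, hT.dilation C K1 h⟫_ℂ = 0
    rw [hT.inner_dilation_transfer B C D K1 K2, star_zero]
  | add_single α i ih =>
    rw [tuplePow_add_single _ HK.commute_Mz]
    change ⟪_, HK.Mz κ E i (tuplePow (HK.Mz κ E) α (hT.transfer B C D K1 y))⟫_ℂ = 0
    rw [← adjoint_inner_left, hT.adjoint_Mz_dilation, ih]

lemma inner_transfer_tuplePow_transfer
    (K2 : adjoint D ∘L C + adjoint B ∘L oplus d hT.DeltaT ∘L adjoint (row T) = 0)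
    (K4 : Set.range (oplus d (hT.dilation C K1) ∘L B)
      ⊆ Set.range (adjoint (row (HK.Mz κ (d := d) E))))
    {α : Fin d → ℕ} (hα : α ≠ 0) (x y : Estar) :
    ⟪hT.transfer B C D K1 x, tuplePow (HK.Mz κ E) α (hT.transfer B C D K1 y)⟫_ℂ = 0 := by
  obtain ⟨i, hi⟩ : ∃ i, α i ≠ 0 := Function.ne_iff.1 hα
  rw [← sub_single_add hi, tuplePow_add_single _ HK.commute_Mz]
  change ⟪_, HK.Mz κ E i (tuplePow (HK.Mz κ E) _ (hT.transfer B C D K1 y))⟫_ℂ = 0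
  rw [← adjoint_inner_left, hT.adjoint_Mz_transfer B C D K1 K4,
    hT.inner_dilation_tuplePow_transfer B C D K1 K2]

end IsPureKContraction

end KInner

end

theorem mainTheorem2 (κ : KInner.KernelSeries)
    (hr : ∃ r : ℝ, Tendsto (fun n => κ.a n / κ.a (n + 1)) atTop (𝓝 r))
    {d : ℕ} {H E Estar : Type*}
    [NormedAddCommGroup H] [InnerProductSpace ℂ H] [CompleteSpace H]
    [NormedAddCommGroup E] [InnerProductSpace ℂ E] [CompleteSpace E]
    [NormedAddCommGroup Estar] [InnerProductSpace ℂ Estar] [CompleteSpace Estar]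
    (T : Fin d → H →L[ℂ] H) (hT : KInner.IsPureKContraction κ T)
    (B : Estar →L[ℂ] PiLp 2 (fun _ : Fin d => H)) (C : H →L[ℂ] E) (D : Estar →L[ℂ] E)
    (K1 : adjoint C ∘L C = hT.defect)
    (K2 : adjoint D ∘L C
      + adjoint B ∘L KInner.oplus d hT.DeltaT ∘L adjoint (KInner.row T) = 0)
    (K3 : adjoint D ∘L D + adjoint B ∘L KInner.oplus d hT.DeltaT ∘L B
      = ContinuousLinearMap.id ℂ Estar)
    (K4 : Set.range (KInner.oplus d (hT.dilation C K1) ∘L B)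
      ⊆ Set.range (adjoint (KInner.row (KInner.HK.Mz κ (d := d) E))))
    (W : EuclideanSpace ℂ (Fin d) → Estar →L[ℂ] E)
    (hW : ∀ z ∈ KInner.Ball d, W z = D + C
      ∘L κ.F (KInner.row (fun i => z i • ContinuousLinearMap.id ℂ H) ∘L adjoint (KInner.row T))
      ∘L KInner.row (fun i => z i • ContinuousLinearMap.id ℂ H) ∘L B) :
    KInner.IsKInner κ W := by
  simp only [KInner.row_comp_adjoint_row] at hW
  simp only [← KInner.rowZ_apply] at hW
  refine ⟨(hT.analyticOnNhd_realization B C D hr).congr Metric.isOpen_ball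
      fun z hz => (hW z hz).symm, ⟨⟨(hT.transfer B C D K1).toLinearMap, fun x => ?_⟩,
      fun x z => ?_, fun α hα x y => ?_⟩⟩
  · rw [ContinuousLinearMap.coe_coe, @norm_eq_sqrt_re_inner ℂ, @norm_eq_sqrt_re_inner ℂ _ _ _ _ x,
      hT.inner_transfer_self B C D K1 K3 K4]
  · rw [hW z z.2]
    exact hT.transfer_apply B C D K1 hr x z
  · exact hT.inner_transfer_tuplePow_transfer B C D K1 K2 K4 hα x y
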